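/- Let $M$ be a 3-dimensional smooth manifold with a smooth almost contact metric structure $(\varphi,\xi,\eta,g)$, i.e. $\varphi^2=-I+\eta\otimes\xi$, $\eta(\xi)=1$ and $g(\varphi X,\varphi Y)=g(X,Y)-\eta(X)\eta(Y)$. Let $\Phi(X,Y)=g(\varphi X,Y)$, let $\alpha$ be a real number, and assume that the structure is almost $\alpha$-cosymplectic: $d\eta=0$ and $d\Phi=2\alpha\,\eta\wedge\Phi$. Let $h=\tfrac12\mathcal L_\xi\varphi$, let $R(X,Y)Z=\nabla_X\nabla_YZ-\nabla_Y\nabla_XZ-\nabla_{[X,Y]}Z$ be the curvature of the Levi-Civita connection $\nabla$ of $g$, and let $Q$ be the Ricci operator, $QX=\sum_i R(X,e_i)e_i$ for an orthonormal frame $(e_i)$. Suppose that there are smooth functions $f_1,f_2$ on $M$ with $$Q\varphi-\varphi Q=f_1\,h\varphi+f_2\,h .$$ Then $M$ is an almost $\alpha$-cosymplectic $(\kappa,\mu,\nu)$-space with $\mu=f_1/2$ and $\nu=f_2/2$; that is, there is a smooth function $\kappa$ on $M$ such that, for $\mu=f_1/2$ and $\nu=f_2/2$, $$R(X,Y)\xi=\eta(Y)(\kappa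 I+\mu h+\nu\varphi h)X-\eta(X)(\kappa I+\mu h+\nu\varphi h)Y$$ for all vector fields $X,Y$. If moreover $df_1\wedge\eta=0$ and $df_2\wedge\eta=0$, then $d\kappa\wedge\eta=0$ for this $\kappa$, so that $\kappa,\mu,\nu$ all lie in the ring $\mathcal R_\eta(M)$ of smooth functions $f$ with $df\wedge\eta=0$. -/

import Mathlib

open Bundle NormedSpace FiberBundle VectorField
open scoped Manifold ContDiff RealInnerProductSpace

set_option linter.unusedSectionVars false

noncomputable section

namespace AlmostCosymplectic

variable {E : Type*} [NormedAddCommGroup E] [NormedSpace ℝ E] [FiniteDimensional ℝ E]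
  {M : Type*} [TopologicalSpace M] [ChartedSpace E M] [IsManifold 𝓘(ℝ, E) ∞ M]
  [RiemannianBundle (fun x : M => TangentSpace 𝓘(ℝ, E) x)]
  [IsContMDiffRiemannianBundle 𝓘(ℝ, E) ∞ E (fun x : M => TangentSpace 𝓘(ℝ, E) x)]

theorem mdiffAt_inner {V W : Π x : M, TangentSpace 𝓘(ℝ, E) x} {x : M}
    (hV : MDiffAt (T% V) x) (hW : MDiffAt (T% W) x) :
    MDiffAt (fun y => ⟪V y, W y⟫) x :=
  MDifferentiableAt.inner_bundle (F := E) (E := fun x : M => TangentSpace 𝓘(ℝ, E) x) hV hW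

/-- The Koszul expression, which is to be `2 g(∇_V Y, W)`:
`V g(Y,W) + Y g(V,W) - W g(V,Y) + g([V,Y],W) - g([V,W],Y) - g([Y,W],V)`. -/
def koszul (Y V W : Π x : M, TangentSpace 𝓘(ℝ, E) x) (x : M) : ℝ :=
  mvfderiv 𝓘(ℝ, E) (fun y => ⟪Y y, W y⟫) x (V x)
    + mvfderiv 𝓘(ℝ, E) (fun y => ⟪V y, W y⟫) x (Y x)
    - mvfderiv 𝓘(ℝ, E) (fun y => ⟪V y, Y y⟫) x (W x)
    + ⟪mlieBracket 𝓘(ℝ, E) V Y x, W x⟫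
    - ⟪mlieBracket 𝓘(ℝ, E) V W x, Y x⟫
    - ⟪mlieBracket 𝓘(ℝ, E) Y W x, V x⟫

theorem mvfderiv_inner_smul_left {f : M → ℝ} {V W : Π x : M, TangentSpace 𝓘(ℝ, E) x} {x : M}
    (hf : MDiffAt f x) (hV : MDiffAt (T% V) x) (hW : MDiffAt (T% W) x)
    (u : TangentSpace 𝓘(ℝ, E) x) :
    mvfderiv 𝓘(ℝ, E) (fun y => ⟪(f • V) y, W y⟫) x u
      = f x * mvfderiv 𝓘(ℝ, E) (fun y => ⟪V y, W y⟫) x u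
        + mvfderiv 𝓘(ℝ, E) f x u * ⟪V x, W x⟫ := by
  have : (fun y => ⟪(f • V) y, W y⟫) = fun y => f y * ⟪V y, W y⟫ := by
    funext y; simp [real_inner_smul_left]
  rw [this, mvfderiv_fun_mul hf (mdiffAt_inner hV hW)]
  simp
  ring

theorem mvfderiv_inner_add_left {V V' W : Π x : M, TangentSpace 𝓘(ℝ, E) x} {x : M}
    (hV : MDiffAt (T% V) x) (hV' : MDiffAt (T% V') x) (hW : MDiffAt (T% W) x)
    (u : TangentSpace 𝓘(ℝ, E) x) :
    mvfderiv 𝓘(ℝ, E) (fun y => ⟪(V + V') y, W y⟫) x u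
      = mvfderiv 𝓘(ℝ, E) (fun y => ⟪V y, W y⟫) x u
        + mvfderiv 𝓘(ℝ, E) (fun y => ⟪V' y, W y⟫) x u := by
  have : (fun y => ⟪(V + V') y, W y⟫) = fun y => ⟪V y, W y⟫ + ⟪V' y, W y⟫ := by
    funext y; simp [inner_add_left]
  rw [this, mvfderiv_fun_add (mdiffAt_inner hV hW) (mdiffAt_inner hV' hW)]
  simp

theorem mvfderiv_inner_comm (V W : Π x : M, TangentSpace 𝓘(ℝ, E) x) :
    mvfderiv 𝓘(ℝ, E) (fun y => ⟪V y, W y⟫) = mvfderiv 𝓘(ℝ, E) (fun y => ⟪W y, V y⟫) := by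
  congr 1; funext y; exact real_inner_comm _ _

theorem koszul_tensorial_left {Y W : Π x : M, TangentSpace 𝓘(ℝ, E) x} {x : M}
    (hY : MDiffAt (T% Y) x) (hW : MDiffAt (T% W) x) :
    TensorialAt 𝓘(ℝ, E) E (fun V => koszul Y V W x) x where
  smul {f V} hf hV := by
    simp only [koszul, mvfderiv_inner_smul_left hf hV hW, mvfderiv_inner_smul_left hf hV hY,
      mlieBracket_smul_left hf hV]
    simp [inner_add_left, real_inner_smul_left, real_inner_smul_right]
    ring
  add {V V'} hV hV' := by
    simp only [koszul, mvfderiv_inner_add_left hV hV' hW, mvfderiv_inner_add_left hV hV' hY,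
      mlieBracket_add_left hV hV']
    simp [inner_add_left, inner_add_right]
    ring

theorem koszul_tensorial_right {Y V : Π x : M, TangentSpace 𝓘(ℝ, E) x} {x : M}
    (hY : MDiffAt (T% Y) x) (hV : MDiffAt (T% V) x) :
    TensorialAt 𝓘(ℝ, E) E (fun W => koszul Y V W x) x where
  smul {f W} hf hW := by
    simp only [koszul, mvfderiv_inner_comm V (f • W), mvfderiv_inner_comm Y (f • W),
      mvfderiv_inner_smul_left hf hW hV, mvfderiv_inner_smul_left hf hW hY,
      mlieBracket_smul_right hf hW]
    simp [inner_add_left, real_inner_smul_left, real_inner_smul_right,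
      mvfderiv_inner_comm W]
    ring
  add {W W'} hW hW' := by
    simp only [koszul, mvfderiv_inner_comm V (W + W'), mvfderiv_inner_comm Y (W + W'),
      mvfderiv_inner_add_left hW hW' hV, mvfderiv_inner_add_left hW hW' hY,
      mlieBracket_add_right hW hW']
    simp [inner_add_left, inner_add_right, mvfderiv_inner_comm W, mvfderiv_inner_comm W']
    ring

/-- The Koszul expression of `Y` at `x` as a bilinear form in the values of `V` and `W` at `x`. -/
def koszulForm (Y : Π x : M, TangentSpace 𝓘(ℝ, E) x) (x : M) (hY : MDiffAt (T% Y) x) :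
    TangentSpace 𝓘(ℝ, E) x →L[ℝ] TangentSpace 𝓘(ℝ, E) x →L[ℝ] ℝ :=
  TensorialAt.mkHom₂ (fun V W => koszul Y V W x) x
    (fun _ hW => koszul_tensorial_left hY hW) (fun _ hV => koszul_tensorial_right hY hV)

instance finiteDimensional_tangentSpace (x : M) : FiniteDimensional ℝ (TangentSpace 𝓘(ℝ, E) x) :=
  inferInstanceAs (FiniteDimensional ℝ E)
instance completeSpace_tangentSpace (x : M) : CompleteSpace (TangentSpace 𝓘(ℝ, E) x) := FiniteDimensional.complete ℝ _

open scoped Classical in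
/-- `∇ Y` at `x`: the linear map `v ↦ ∇_v Y` with `2 g(∇_v Y, w)` given by the Koszul expression. -/
def leviCivitaFun (Y : Π x : M, TangentSpace 𝓘(ℝ, E) x) (x : M) :
    TangentSpace 𝓘(ℝ, E) x →L[ℝ] TangentSpace 𝓘(ℝ, E) x :=
  if hY : MDiffAt (T% Y) x then
    (1 / 2 : ℝ) • ((InnerProductSpace.toDual ℝ
      (TangentSpace 𝓘(ℝ, E) x)).symm.toContinuousLinearEquiv.toContinuousLinearMap ∘L
        koszulForm Y x hY)
  else 0

theorem two_mul_inner_leviCivitaFun {Y V W : Π x : M, TangentSpace 𝓘(ℝ, E) x} {x : M}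
    (hY : MDiffAt (T% Y) x) (hV : MDiffAt (T% V) x) (hW : MDiffAt (T% W) x) :
    2 * ⟪leviCivitaFun Y x (V x), W x⟫ = koszul Y V W x := by
  have h : koszulForm Y x hY (V x) (W x) = koszul Y V W x :=
    TensorialAt.mkHom₂_apply _ _ hV hW
  rw [← h, leviCivitaFun, dif_pos hY]
  simp [real_inner_smul_left]

theorem leviCivitaFun_eq_of_inner {Y : Π x : M, TangentSpace 𝓘(ℝ, E) x} {x : M}
    (hY : MDiffAt (T% Y) x)
    (D : TangentSpace 𝓘(ℝ, E) x →L[ℝ] TangentSpace 𝓘(ℝ, E) x)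
    (h : ∀ V W : Π x : M, TangentSpace 𝓘(ℝ, E) x, MDiffAt (T% V) x → MDiffAt (T% W) x →
      2 * ⟪D (V x), W x⟫ = koszul Y V W x) :
    leviCivitaFun Y x = D := by
  ext1 v
  refine ext_inner_right ℝ fun w => ?_
  have hv := mdifferentiableAt_extend 𝓘(ℝ, E) E v
  have hw := mdifferentiableAt_extend 𝓘(ℝ, E) E w
  have h1 := two_mul_inner_leviCivitaFun hY hv hw
  have h2 := h _ _ hv hw
  simp only [extend_apply_self] at h1 h2
  linarith

theorem koszul_add {Y Y' V W : Π x : M, TangentSpace 𝓘(ℝ, E) x} {x : M}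
    (hY : MDiffAt (T% Y) x) (hY' : MDiffAt (T% Y') x)
    (hV : MDiffAt (T% V) x) (hW : MDiffAt (T% W) x) :
    koszul (Y + Y') V W x = koszul Y V W x + koszul Y' V W x := by
  simp only [koszul, mvfderiv_inner_comm V (Y + Y'), mvfderiv_inner_add_left hY hY' hV,
    mvfderiv_inner_add_left hY hY' hW, mlieBracket_add_right hY hY', mlieBracket_add_left hY hY']
  simp [inner_add_left, inner_add_right, mvfderiv_inner_comm Y V, mvfderiv_inner_comm Y' V]
  ring

theorem koszul_smul {f : M → ℝ} {Y V W : Π x : M, TangentSpace 𝓘(ℝ, E) x} {x : M}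
    (hf : MDiffAt f x) (hY : MDiffAt (T% Y) x) (hV : MDiffAt (T% V) x) (hW : MDiffAt (T% W) x) :
    koszul (f • Y) V W x
      = f x * koszul Y V W x + 2 * (mvfderiv 𝓘(ℝ, E) f x (V x) * ⟪Y x, W x⟫) := by
  simp only [koszul, mvfderiv_inner_comm V (f • Y), mvfderiv_inner_smul_left hf hY hV,
    mvfderiv_inner_smul_left hf hY hW, mlieBracket_smul_right hf hY, mlieBracket_smul_left hf hY]
  simp [inner_add_left, real_inner_smul_left, real_inner_smul_right, mvfderiv_inner_comm Y V]
  ring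

/-- The Levi-Civita connection of the metric: `leviCivita Y x v` is `∇_v Y` at `x`. -/
def leviCivita : CovariantDerivative 𝓘(ℝ, E) E (fun x : M => TangentSpace 𝓘(ℝ, E) x) where
  toFun := leviCivitaFun
  isCovariantDerivativeOnUniv :=
    { add := by
        intro Y Y' x hY hY' _
        refine leviCivitaFun_eq_of_inner (mdifferentiableAt_add_section hY hY') _
          fun V W hV hW => ?_
        rw [koszul_add hY hY' hV hW, ← two_mul_inner_leviCivitaFun hY hV hW,
          ← two_mul_inner_leviCivitaFun hY' hV hW]
        simp [inner_add_left]
        ring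
      leibniz := by
        intro Y f x hY hf _
        refine leviCivitaFun_eq_of_inner (hf.smul_section hY) _
          fun V W hV hW => ?_
        rw [koszul_smul hf hY hV hW, ← two_mul_inner_leviCivitaFun hY hV hW]
        simp [inner_add_left, real_inner_smul_left]
        ring }

/-- The Levi-Civita connection is torsion-free. -/
theorem leviCivita_torsion :
    (leviCivita (E := E) (M := M)).torsion = 0 := by
  rw [CovariantDerivative.torsion_eq_zero_iff]
  intro X Y x hX hY
  refine ext_inner_right ℝ fun w => ?_
  have hw := mdifferentiableAt_extend 𝓘(ℝ, E) E w
  have h1 := two_mul_inner_leviCivitaFun hY hX hw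
  have h2 := two_mul_inner_leviCivitaFun hX hY hw
  simp only [extend_apply_self, koszul] at h1 h2
  rw [mvfderiv_inner_comm Y X, mlieBracket_swap_apply (V := Y) (W := X)] at h2
  simp only [inner_neg_left] at h2
  change ⟪leviCivitaFun Y x (X x) - leviCivitaFun X x (Y x), w⟫ = _
  rw [inner_sub_left]
  linarith

/-- The Levi-Civita connection is compatible with the metric:
`X g(Y, Z) = g(∇_X Y, Z) + g(Y, ∇_X Z)`. -/
theorem mvfderiv_inner_leviCivita {X Y Z : Π x : M, TangentSpace 𝓘(ℝ, E) x} {x : M}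
    (hX : MDiffAt (T% X) x) (hY : MDiffAt (T% Y) x) (hZ : MDiffAt (T% Z) x) :
    mvfderiv 𝓘(ℝ, E) (fun y => ⟪Y y, Z y⟫) x (X x)
      = ⟪leviCivita Y x (X x), Z x⟫ + ⟪Y x, leviCivita Z x (X x)⟫ := by
  have h1 := two_mul_inner_leviCivitaFun hY hX hZ
  have h2 := two_mul_inner_leviCivitaFun hZ hX hY
  rw [real_inner_comm] at h2
  simp only [koszul] at h1 h2
  rw [mvfderiv_inner_comm Z Y, mlieBracket_swap_apply (V := Z) (W := Y)] at h2
  simp only [inner_neg_left] at h2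
  change _ = ⟪leviCivitaFun Y x (X x), Z x⟫ + ⟪Y x, leviCivitaFun Z x (X x)⟫
  linarith

/-- The curvature operator on vector fields,
`R(X,Y)Z = ∇_X ∇_Y Z - ∇_Y ∇_X Z - ∇_[X,Y] Z`. -/
def curvatureField (X Y Z : Π x : M, TangentSpace 𝓘(ℝ, E) x) (x : M) : TangentSpace 𝓘(ℝ, E) x :=
  leviCivita (fun y => leviCivita Z y (Y y)) x (X x)
    - leviCivita (fun y => leviCivita Z y (X y)) x (Y x)
    - leviCivita Z x (mlieBracket 𝓘(ℝ, E) X Y x)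

/-- The curvature tensor `R(u,v)w` at the point `x`, computed by means of local vector fields
extending `u`, `v`, `w` (the choice of which is immaterial). -/
def curvature (x : M) (u v w : TangentSpace 𝓘(ℝ, E) x) : TangentSpace 𝓘(ℝ, E) x :=
  curvatureField (extend E u) (extend E v) (extend E w) x

/-- The Ricci operator `Q v = ∑ᵢ R(v, eᵢ) eᵢ`, for an orthonormal basis `(eᵢ)` of the tangent space,
so that `g(Q v, w) = S(v, w)` is the Ricci tensor. -/
def ricciOperator (x : M) (v : TangentSpace 𝓘(ℝ, E) x) : TangentSpace 𝓘(ℝ, E) x :=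
  ∑ i, curvature x v (stdOrthonormalBasis ℝ (TangentSpace 𝓘(ℝ, E) x) i)
    (stdOrthonormalBasis ℝ (TangentSpace 𝓘(ℝ, E) x) i)

/-! ### Differential forms -/

/-- The exterior derivative `dη(u, v)` of a 1-form `η` at `x`:
`dη(X,Y) = X(η Y) - Y(η X) - η [X,Y]` for local vector fields `X`, `Y` extending `u`, `v`. -/
def dOneForm (η : Π x : M, TangentSpace 𝓘(ℝ, E) x →L[ℝ] ℝ) (x : M)
    (u v : TangentSpace 𝓘(ℝ, E) x) : ℝ :=
  mvfderiv 𝓘(ℝ, E) (fun y => η y (extend E v y)) x u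
    - mvfderiv 𝓘(ℝ, E) (fun y => η y (extend E u y)) x v
    - η x (mlieBracket 𝓘(ℝ, E) (extend E u) (extend E v) x)

/-- The exterior derivative of a 2-form `Ω` at `x`:
`dΩ(X,Y,Z) = X Ω(Y,Z) + Y Ω(Z,X) + Z Ω(X,Y) - Ω([X,Y],Z) - Ω([Y,Z],X) - Ω([Z,X],Y)`
for local vector fields `X`, `Y`, `Z` extending `u`, `v`, `w`. -/
def dTwoForm (Ω : Π x : M, TangentSpace 𝓘(ℝ, E) x → TangentSpace 𝓘(ℝ, E) x → ℝ) (x : M)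
    (u v w : TangentSpace 𝓘(ℝ, E) x) : ℝ :=
  mvfderiv 𝓘(ℝ, E) (fun y => Ω y (extend E v y) (extend E w y)) x u
    + mvfderiv 𝓘(ℝ, E) (fun y => Ω y (extend E w y) (extend E u y)) x v
    + mvfderiv 𝓘(ℝ, E) (fun y => Ω y (extend E u y) (extend E v y)) x w
    - Ω x (mlieBracket 𝓘(ℝ, E) (extend E u) (extend E v) x) w
    - Ω x (mlieBracket 𝓘(ℝ, E) (extend E v) (extend E w) x) u
    - Ω x (mlieBracket 𝓘(ℝ, E) (extend E w) (extend E u) x) v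

/-- The wedge product `η ∧ Ω` of a 1-form and a 2-form at `x`, evaluated on `u`, `v`, `w`. -/
def wedgeOneTwo (η : Π x : M, TangentSpace 𝓘(ℝ, E) x →L[ℝ] ℝ)
    (Ω : Π x : M, TangentSpace 𝓘(ℝ, E) x → TangentSpace 𝓘(ℝ, E) x → ℝ) (x : M)
    (u v w : TangentSpace 𝓘(ℝ, E) x) : ℝ :=
  η x u * Ω x v w + η x v * Ω x w u + η x w * Ω x u v

/-! ### Almost contact metric and almost `α`-cosymplectic structures -/

/-- `(φ, ξ, η, g)` is a (smooth) almost contact metric structure on `M`, where `g` is the given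
Riemannian metric of `M`. -/
structure IsAlmostContactMetric
    (φ : Π x : M, TangentSpace 𝓘(ℝ, E) x →L[ℝ] TangentSpace 𝓘(ℝ, E) x)
    (ξ : Π x : M, TangentSpace 𝓘(ℝ, E) x)
    (η : Π x : M, TangentSpace 𝓘(ℝ, E) x →L[ℝ] ℝ) : Prop where
  contMDiff_phi : ContMDiff 𝓘(ℝ, E) (𝓘(ℝ, E).prod 𝓘(ℝ, E →L[ℝ] E)) ∞
    (fun x => TotalSpace.mk' (E →L[ℝ] E) x (φ x))
  contMDiff_xi : ContMDiff 𝓘(ℝ, E) (𝓘(ℝ, E).prod 𝓘(ℝ, E)) ∞ (fun x => TotalSpace.mk' E x (ξ x))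
  contMDiff_eta : ContMDiff 𝓘(ℝ, E) (𝓘(ℝ, E).prod 𝓘(ℝ, E →L[ℝ] ℝ)) ∞
    (fun x => TotalSpace.mk' (E →L[ℝ] ℝ) x (η x))
  phi_phi : ∀ x v, φ x (φ x v) = -v + η x v • ξ x
  eta_xi : ∀ x, η x (ξ x) = 1
  inner_phi_phi : ∀ x u v, ⟪φ x u, φ x v⟫ = ⟪u, v⟫ - η x u * η x v

/-- The fundamental 2-form `Φ(u, v) = g(φ u, v)`. -/
def fundamentalForm (φ : Π x : M, TangentSpace 𝓘(ℝ, E) x →L[ℝ] TangentSpace 𝓘(ℝ, E) x)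
    (x : M) (u v : TangentSpace 𝓘(ℝ, E) x) : ℝ := ⟪φ x u, v⟫

/-- `(φ, ξ, η, g)` is an almost `α`-cosymplectic structure: an almost contact metric structure with
`dη = 0` and `dΦ = 2 α η ∧ Φ`. -/
structure IsAlmostCosymplectic (α : ℝ)
    (φ : Π x : M, TangentSpace 𝓘(ℝ, E) x →L[ℝ] TangentSpace 𝓘(ℝ, E) x)
    (ξ : Π x : M, TangentSpace 𝓘(ℝ, E) x)
    (η : Π x : M, TangentSpace 𝓘(ℝ, E) x →L[ℝ] ℝ) : Prop
    extends IsAlmostContactMetric φ ξ η where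
  d_eta : ∀ x u v, dOneForm η x u v = 0
  d_fundamentalForm : ∀ x u v w, dTwoForm (fundamentalForm φ) x u v w
    = 2 * α * wedgeOneTwo η (fundamentalForm φ) x u v w

/-- The tensor field `h = (1/2) L_ξ φ`, that is `h X = (1/2) ([ξ, φ X] - φ [ξ, X])`, evaluated at
`v` by means of a local vector field `X` extending `v`. -/
def hTensor (φ : Π x : M, TangentSpace 𝓘(ℝ, E) x →L[ℝ] TangentSpace 𝓘(ℝ, E) x)
    (ξ : Π x : M, TangentSpace 𝓘(ℝ, E) x) (x : M) (v : TangentSpace 𝓘(ℝ, E) x) :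
    TangentSpace 𝓘(ℝ, E) x :=
  (1 / 2 : ℝ) • (mlieBracket 𝓘(ℝ, E) ξ (fun y => φ y (extend E v y)) x
    - φ x (mlieBracket 𝓘(ℝ, E) ξ (extend E v) x))

/-- The operator `κ I + μ h + ν φ h`. -/
def nullityOperator (φ : Π x : M, TangentSpace 𝓘(ℝ, E) x →L[ℝ] TangentSpace 𝓘(ℝ, E) x)
    (ξ : Π x : M, TangentSpace 𝓘(ℝ, E) x) (κ μ ν : M → ℝ) (x : M)
    (v : TangentSpace 𝓘(ℝ, E) x) : TangentSpace 𝓘(ℝ, E) x :=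
  κ x • v + μ x • hTensor φ ξ x v + ν x • φ x (hTensor φ ξ x v)

/-- `(φ, ξ, η, g)` is an almost `α`-cosymplectic `(κ, μ, ν)`-structure, for smooth functions
`κ`, `μ`, `ν`:
`R(X,Y)ξ = η(Y)(κ I + μ h + ν φ h)X - η(X)(κ I + μ h + ν φ h)Y`. -/
structure IsAlmostCosymplecticSpace (α : ℝ)
    (φ : Π x : M, TangentSpace 𝓘(ℝ, E) x →L[ℝ] TangentSpace 𝓘(ℝ, E) x)
    (ξ : Π x : M, TangentSpace 𝓘(ℝ, E) x)
    (η : Π x : M, TangentSpace 𝓘(ℝ, E) x →L[ℝ] ℝ) (κ μ ν : M → ℝ) : Prop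
    extends IsAlmostCosymplectic α φ ξ η where
  contMDiff_kappa : ContMDiff 𝓘(ℝ, E) 𝓘(ℝ, ℝ) ∞ κ
  contMDiff_mu : ContMDiff 𝓘(ℝ, E) 𝓘(ℝ, ℝ) ∞ μ
  contMDiff_nu : ContMDiff 𝓘(ℝ, E) 𝓘(ℝ, ℝ) ∞ ν
  curvature_xi : ∀ x u v, curvature x u v (ξ x)
    = η x v • nullityOperator φ ξ κ μ ν x u - η x u • nullityOperator φ ξ κ μ ν x v

/-- `df ∧ η = 0`: membership of the smooth function `f` in the ring `R_η(M)`. -/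
def DWedgeEtaEqZero (η : Π x : M, TangentSpace 𝓘(ℝ, E) x →L[ℝ] ℝ) (f : M → ℝ) : Prop :=
  ∀ (x : M) (u v : TangentSpace 𝓘(ℝ, E) x),
    mvfderiv 𝓘(ℝ, E) f x u * η x v - mvfderiv 𝓘(ℝ, E) f x v * η x u = 0

end AlmostCosymplectic

end

/-!
Near each point there is an orthonormal frame `(e₀, e₁, e₂) = (e₀, φ e₀, ξ)`. In such a frame the
conditions `dη = 0` and `dΦ = 2 α η ∧ Φ` say that `∇ξ` is symmetric with `∇_ξ ξ = 0` and trace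
`2 α`, so the connection is described by `α`, by the components `p = g(h e₀, e₀)` and
`q = g(h e₀, e₁)` of `h`, and by the three functions `Γᵢ₀₁ = g(∇_{eᵢ} e₀, e₁)`. The curvature is
then an explicit expression in these functions and their derivatives (`curvCoeff_0220` and the
lemmas after it).

*The nullity condition.* In dimension three the components of `R(X, Y)ξ` are, by the symmetries of
the curvature tensor, linear combinations of components of the Ricci operator. The commutator condition,
evaluated at `ξ`, says that `ξ` is an eigenvector of `Q`, which kills `R(e₀, e₁)ξ`. Evaluated at
`e₀`, it determines the trace-free part of `v ↦ R(v, ξ)ξ` on the plane orthogonal to `ξ` as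
`(f₁/2) h + (f₂/2) φ h`. The trace of this operator is `2 κ`, where `κ = g(Qξ, ξ)/2`; this is
`curvature_xi`. Moreover `κ = -(α² + p² + q²)` (`kappa_eq`).

*The differential of `κ`.* Where `p² + q² = 0`, the formula for `κ` gives `dκ = 0`. Elsewhere the
frame can be chosen with `q = 0` (`exists_hOff_eq_zero`). The formulas for the curvature then
express `Γ₂₀₁` by `f₁` and all first derivatives of `p` by `p`, `f₂`, `Γ₀₀₁`, `Γ₁₀₁`. If `f₁` and
`f₂` have no derivative orthogonal to `ξ`, comparing the integrability conditions
`[eᵢ, ξ] p = eᵢ (ξ p) - ξ (eᵢ p)` with `g(Qξ, eᵢ) = 0` gives `Γ₀₀₁ = Γ₁₀₁ = 0`, hence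
`e₀ p = e₁ p = 0` (`mvfderiv_hDiag_eq_zero`), which is `dκ ∧ η = 0`.

Mathlib has neither the smoothness of the Levi-Civita connection, nor the tensoriality and the
symmetries of its curvature, nor the commutator formula `[X, Y] f = X (Y f) - Y (X f)` on
manifolds. The last is obtained from the Jacobi identity for `X`, `Y`, `f W`
(`mvfderiv_mlieBracket`); the others follow from the Koszul formula in an orthonormal frame.
-/

noncomputable section

namespace AlmostCosymplectic

open Filter
open scoped Topology

variable {E : Type*} [NormedAddCommGroup E] [NormedSpace ℝ E] [FiniteDimensional ℝ E]
  {M : Type*} [TopologicalSpace M] [ChartedSpace E M] [IsManifold 𝓘(ℝ, E) ∞ M]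
  [RiemannianBundle (fun x : M => TangentSpace 𝓘(ℝ, E) x)]
  [IsContMDiffRiemannianBundle 𝓘(ℝ, E) ∞ E (fun x : M => TangentSpace 𝓘(ℝ, E) x)]

/-! ### Germs of smooth functions and vector fields -/

/-- The vector field `X` is smooth in a neighbourhood of `x`. (For the exponent `∞`, this is
stronger than `ContMDiffAt` at the point `x`.) -/
def SmoothNear (X : Π x : M, TangentSpace 𝓘(ℝ, E) x) (x : M) : Prop :=
  ∀ᶠ y in 𝓝 x, ContMDiffAt 𝓘(ℝ, E) (𝓘(ℝ, E).prod 𝓘(ℝ, E)) ∞ (T% X) y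

/-- The real function `f` is smooth in a neighbourhood of `x`. -/
def SmoothFunNear (f : M → ℝ) (x : M) : Prop :=
  ∀ᶠ y in 𝓝 x, ContMDiffAt 𝓘(ℝ, E) 𝓘(ℝ, ℝ) ∞ f y

variable {X Y Z W : Π x : M, TangentSpace 𝓘(ℝ, E) x} {f g : M → ℝ} {x : M}

namespace SmoothFunNear

theorem eventually (hf : SmoothFunNear (E := E) f x) :
    ∀ᶠ y in 𝓝 x, SmoothFunNear (E := E) f y :=
  eventually_eventually_nhds.2 hf

theorem contMDiffAt (hf : SmoothFunNear (E := E) f x) : ContMDiffAt 𝓘(ℝ, E) 𝓘(ℝ, ℝ) ∞ f x :=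
  hf.self_of_nhds

theorem mdiffAt (hf : SmoothFunNear (E := E) f x) : MDifferentiableAt 𝓘(ℝ, E) 𝓘(ℝ, ℝ) f x :=
  hf.contMDiffAt.mdifferentiableAt (by simp)

theorem congr (hf : SmoothFunNear (E := E) f x) (h : g =ᶠ[𝓝 x] f) :
    SmoothFunNear (E := E) g x := by
  filter_upwards [hf, h.eventuallyEq_nhds] with y hy hgy
  exact hy.congr_of_eventuallyEq hgy

theorem const (c : ℝ) : SmoothFunNear (E := E) (fun _ : M => c) x :=
  Eventually.of_forall fun _ => contMDiffAt_const

theorem add (hf : SmoothFunNear (E := E) f x) (hg : SmoothFunNear (E := E) g x) :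
    SmoothFunNear (E := E) (fun y => f y + g y) x := by
  filter_upwards [hf, hg] with y h1 h2 using h1.add h2

theorem sub (hf : SmoothFunNear (E := E) f x) (hg : SmoothFunNear (E := E) g x) :
    SmoothFunNear (E := E) (fun y => f y - g y) x := by
  filter_upwards [hf, hg] with y h1 h2 using h1.sub h2

theorem neg (hf : SmoothFunNear (E := E) f x) : SmoothFunNear (E := E) (fun y => -f y) x := by
  filter_upwards [hf] with y h1 using h1.neg

theorem mul (hf : SmoothFunNear (E := E) f x) (hg : SmoothFunNear (E := E) g x) :
    SmoothFunNear (E := E) (fun y => f y * g y) x := by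
  filter_upwards [hf, hg] with y h1 h2
  exact h1.mul h2

theorem comp_contDiffAt {F : ℝ → ℝ} (hf : SmoothFunNear (E := E) f x)
    (hF : ∀ t, t ≠ 0 → ContDiffAt ℝ ∞ F t) (h0 : f x ≠ 0) :
    SmoothFunNear (E := E) (fun y => F (f y)) x := by
  filter_upwards [hf, hf.contMDiffAt.continuousAt.eventually_ne h0] with y h1 h2
  exact (hF _ h2).contMDiffAt.comp y h1

theorem sqrt (hf : SmoothFunNear (E := E) f x) (h0 : f x ≠ 0) :
    SmoothFunNear (E := E) (fun y => √(f y)) x :=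
  hf.comp_contDiffAt (fun _ h => Real.contDiffAt_sqrt h) h0

theorem inv (hf : SmoothFunNear (E := E) f x) (h0 : f x ≠ 0) :
    SmoothFunNear (E := E) (fun y => (f y)⁻¹) x :=
  hf.comp_contDiffAt (fun _ h => contDiffAt_inv ℝ h) h0

theorem of_contMDiff (hf : ContMDiff 𝓘(ℝ, E) 𝓘(ℝ, ℝ) ∞ f) : SmoothFunNear (E := E) f x :=
  Eventually.of_forall fun y => hf y

end SmoothFunNear

theorem smoothNear_extend (v : TangentSpace 𝓘(ℝ, E) x) : SmoothNear (extend E v) x := by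
  obtain ⟨s, hs, h⟩ := exists_contMDiffOn_extend (k := ∞) 𝓘(ℝ, E) E v
  filter_upwards [eventually_mem_nhds_iff.2 hs] with y hy using h.contMDiffAt hy

namespace SmoothNear

theorem eventually (hX : SmoothNear X x) : ∀ᶠ y in 𝓝 x, SmoothNear X y :=
  eventually_eventually_nhds.2 hX

theorem contMDiffAt (hX : SmoothNear X x) :
    ContMDiffAt 𝓘(ℝ, E) (𝓘(ℝ, E).prod 𝓘(ℝ, E)) ∞ (T% X) x :=
  hX.self_of_nhds

theorem mdiffAt (hX : SmoothNear X x) : MDiffAt (T% X) x :=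
  hX.contMDiffAt.mdifferentiableAt (by simp)

theorem congr (hX : SmoothNear X x) (h : ∀ᶠ y in 𝓝 x, Y y = X y) : SmoothNear Y x := by
  filter_upwards [hX, eventually_eventually_nhds.2 h] with y hy hXY
  exact hy.congr_of_eventuallyEq (hXY.mono fun z hz => by simp [hz])

theorem zero : SmoothNear (0 : Π x : M, TangentSpace 𝓘(ℝ, E) x) x :=
  Eventually.of_forall fun y => contMDiff_zeroSection ℝ _ y

theorem add (hX : SmoothNear X x) (hY : SmoothNear Y x) : SmoothNear (X + Y) x := by
  filter_upwards [hX, hY] with y h1 h2 using h1.add_section h2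

theorem sub (hX : SmoothNear X x) (hY : SmoothNear Y x) : SmoothNear (X - Y) x := by
  filter_upwards [hX, hY] with y h1 h2 using h1.sub_section h2

theorem smul (hf : SmoothFunNear (E := E) f x) (hX : SmoothNear X x) : SmoothNear (f • X) x := by
  filter_upwards [hf, hX] with y h1 h2 using h1.smul_section h2

theorem sum {ι : Type*} {s : Finset ι} {V : ι → Π x : M, TangentSpace 𝓘(ℝ, E) x}
    (h : ∀ i ∈ s, SmoothNear (V i) x) : SmoothNear (fun y => ∑ i ∈ s, V i y) x := by
  have h' : ∀ᶠ y in 𝓝 x, ∀ i ∈ s,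
      ContMDiffAt 𝓘(ℝ, E) (𝓘(ℝ, E).prod 𝓘(ℝ, E)) ∞ (T% (V i)) y := by
    rwa [Filter.eventually_all_finset]
  filter_upwards [h'] with y hy using ContMDiffAt.sum_section hy

theorem inner (hX : SmoothNear X x) (hY : SmoothNear Y x) :
    SmoothFunNear (E := E) (fun y => ⟪X y, Y y⟫) x := by
  filter_upwards [hX, hY] with y h1 h2 using ContMDiffAt.inner_bundle h1 h2

theorem mlieBracket (hX : SmoothNear X x) (hY : SmoothNear Y x) :
    SmoothNear (mlieBracket 𝓘(ℝ, E) X Y) x := by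
  filter_upwards [hX, hY] with y h1 h2
  have : IsManifold 𝓘(ℝ, E) (((⊤ : ℕ∞) : WithTop ℕ∞) + 1) M := by
    simpa using (inferInstance : IsManifold 𝓘(ℝ, E) ∞ M)
  have : IsManifold 𝓘(ℝ, E) (minSmoothness ℝ 2) M := by
    rw [minSmoothness_of_isRCLikeNormedField]
    infer_instance
  exact ContMDiffAt.mlieBracket_vectorField (m := ⊤) (n := ⊤) h1 h2 (by simp)

theorem clm_apply {φ : Π x : M, TangentSpace 𝓘(ℝ, E) x →L[ℝ] TangentSpace 𝓘(ℝ, E) x}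
    (hφ : ContMDiff 𝓘(ℝ, E) (𝓘(ℝ, E).prod 𝓘(ℝ, E →L[ℝ] E)) ∞
      (fun x => TotalSpace.mk' (E →L[ℝ] E) x (φ x)))
    (hX : SmoothNear X x) : SmoothNear (fun y => φ y (X y)) x := by
  filter_upwards [hX] with y h1 using (hφ y).clm_bundle_apply h1

end SmoothNear

/-! ### The commutator of vector fields as derivations -/

/-- The Jacobi identity for `X`, `Y`, `f • W` with `W` nonzero at `x`, expanded by the Leibniz
rule, contains this commutator formula. -/
theorem mvfderiv_mlieBracket_of_smul {W : Π x : M, TangentSpace 𝓘(ℝ, E) x}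
    (hf : SmoothFunNear (E := E) f x) (hX : SmoothNear X x) (hY : SmoothNear Y x)
    (hW : SmoothNear W x) (hX' : SmoothFunNear (E := E) (fun y => mvfderiv 𝓘(ℝ, E) f y (X y)) x)
    (hY' : SmoothFunNear (E := E) (fun y => mvfderiv 𝓘(ℝ, E) f y (Y y)) x) (h0 : W x ≠ 0) :
    mvfderiv 𝓘(ℝ, E) f x (mlieBracket 𝓘(ℝ, E) X Y x)
      = mvfderiv 𝓘(ℝ, E) (fun y => mvfderiv 𝓘(ℝ, E) f y (Y y)) x (X x)
        - mvfderiv 𝓘(ℝ, E) (fun y => mvfderiv 𝓘(ℝ, E) f y (X y)) x (Y x) := by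
  have hsm : ∀ {V : Π x : M, TangentSpace 𝓘(ℝ, E) x}, SmoothNear V x →
      ∀ᶠ y in 𝓝 x, mlieBracket 𝓘(ℝ, E) V (f • W) y
        = ((fun y => mvfderiv 𝓘(ℝ, E) f y (V y)) • W + f • mlieBracket 𝓘(ℝ, E) V W) y := by
    intro V hV
    filter_upwards [hf.eventually, hW.eventually] with y h1 h2
    simpa using mlieBracket_smul_right h1.mdiffAt h2.mdiffAt
  have : IsManifold 𝓘(ℝ, E) (minSmoothness ℝ 3) M := by
    rw [minSmoothness_of_isRCLikeNormedField]
    infer_instance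
  have hle : minSmoothness ℝ 2 ≤ ∞ := by
    rw [minSmoothness_of_isRCLikeNormedField]; exact ENat.LEInfty.out
  have hfW := SmoothNear.smul hf hW
  have J := leibniz_identity_mlieBracket_apply (hX.contMDiffAt.of_le hle)
    (hY.contMDiffAt.of_le hle) (hfW.contMDiffAt.of_le hle)
  have J' := leibniz_identity_mlieBracket_apply (hX.contMDiffAt.of_le hle)
    (hY.contMDiffAt.of_le hle) (hW.contMDiffAt.of_le hle)
  rw [Filter.EventuallyEq.mlieBracket_vectorField_eq (EventuallyEq.refl _ X) (hsm hY),
    Filter.EventuallyEq.mlieBracket_vectorField_eq (EventuallyEq.refl _ Y) (hsm hX),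
    mlieBracket_smul_right hf.mdiffAt hW.mdiffAt,
    mlieBracket_add_right (SmoothNear.smul hY' hW).mdiffAt
      (SmoothNear.smul hf (hY.mlieBracket hW)).mdiffAt,
    mlieBracket_add_right (SmoothNear.smul hX' hW).mdiffAt
      (SmoothNear.smul hf (hX.mlieBracket hW)).mdiffAt,
    mlieBracket_smul_right hY'.mdiffAt hW.mdiffAt, mlieBracket_smul_right hX'.mdiffAt hW.mdiffAt,
    mlieBracket_smul_right hf.mdiffAt (hY.mlieBracket hW).mdiffAt,
    mlieBracket_smul_right hf.mdiffAt (hX.mlieBracket hW).mdiffAt, J'] at J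
  rw [← sub_eq_zero]
  refine (smul_eq_zero.1 (?_ : _ • W x = 0)).resolve_right h0
  rw [← sub_eq_zero] at J
  rw [← neg_eq_zero, ← J]
  module

/-- The derivative of a smooth function along a smooth vector field is smooth: for `W` nonvanishing
near `x`, it is read off from `[X, f W] = (X f) W + f [X, W]`. -/
theorem SmoothFunNear.mvfderiv [Nontrivial E] (hf : SmoothFunNear (E := E) f x)
    (hX : SmoothNear X x) : SmoothFunNear (E := E) (fun y => mvfderiv 𝓘(ℝ, E) f y (X y)) x := by
  obtain ⟨w, hw⟩ := exists_ne (0 : E)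
  let W : Π x : M, TangentSpace 𝓘(ℝ, E) x := extend E (show TangentSpace 𝓘(ℝ, E) x from w)
  have hWx : W x = w := extend_apply_self ..
  have hW : SmoothNear W x := smoothNear_extend _
  have h0 : ⟪W x, W x⟫ ≠ 0 := by
    rw [Ne, inner_self_eq_zero, hWx]; exact hw
  have h1 : SmoothFunNear (E := E) (fun y =>
      ⟪(VectorField.mlieBracket 𝓘(ℝ, E) X (f • W) - f • VectorField.mlieBracket 𝓘(ℝ, E) X W) y, W y⟫
        * ⟪W y, W y⟫⁻¹) x :=
    (((hX.mlieBracket (SmoothNear.smul hf hW)).sub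
      (SmoothNear.smul hf (hX.mlieBracket hW))).inner hW).mul ((hW.inner hW).inv h0)
  refine h1.congr ?_
  filter_upwards [hf.eventually, hW.eventually,
    (hW.inner hW).contMDiffAt.continuousAt.eventually_ne h0] with y h2 h3 h4
  have := mlieBracket_smul_right (V := X) h2.mdiffAt h3.mdiffAt
  simp only [Pi.sub_apply, this, Pi.smul_apply', add_sub_cancel_right, real_inner_smul_left]
  field_simp

/-- `[X, Y] f = X (Y f) - Y (X f)`. -/
theorem mvfderiv_mlieBracket [Nontrivial E] (hf : SmoothFunNear (E := E) f x)
    (hX : SmoothNear X x) (hY : SmoothNear Y x) :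
    mvfderiv 𝓘(ℝ, E) f x (mlieBracket 𝓘(ℝ, E) X Y x)
      = mvfderiv 𝓘(ℝ, E) (fun y => mvfderiv 𝓘(ℝ, E) f y (Y y)) x (X x)
        - mvfderiv 𝓘(ℝ, E) (fun y => mvfderiv 𝓘(ℝ, E) f y (X y)) x (Y x) := by
  obtain ⟨w, hw⟩ := exists_ne (0 : E)
  refine mvfderiv_mlieBracket_of_smul hf hX hY
    (smoothNear_extend (show TangentSpace 𝓘(ℝ, E) x from w)) (hf.mvfderiv hX) (hf.mvfderiv hY) ?_
  rw [extend_apply_self]; exact hw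

/-! ### Calculus of the Levi-Civita connection -/

theorem mvfderiv_congr (h : f =ᶠ[𝓝 x] g) : mvfderiv 𝓘(ℝ, E) f x = mvfderiv 𝓘(ℝ, E) g x := by
  ext v
  simp only [mvfderiv, ContinuousLinearMap.comp_apply, h.mfderiv_eq]
  rfl

theorem mvfderiv_eq_zero_of_eventually_const {c : ℝ} (h : ∀ᶠ y in 𝓝 x, f y = c) :
    mvfderiv 𝓘(ℝ, E) f x = 0 := by
  rw [mvfderiv_congr (g := fun _ => c) h, mvfderiv_const]

theorem leviCivita_smul (hf : MDiffAt f x) (hX : MDiffAt (T% X) x) (v : TangentSpace 𝓘(ℝ, E) x) :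
    leviCivita (f • X) x v = f x • leviCivita X x v + mvfderiv 𝓘(ℝ, E) f x v • X x := by
  have := leviCivita.isCovariantDerivativeOnUniv.leibniz hX hf (by trivial)
  rw [this]
  simp

theorem leviCivita_add (hX : MDiffAt (T% X) x) (hY : MDiffAt (T% Y) x)
    (v : TangentSpace 𝓘(ℝ, E) x) :
    leviCivita (X + Y) x v = leviCivita X x v + leviCivita Y x v := by
  have := leviCivita.isCovariantDerivativeOnUniv.add hX hY (by trivial)
  rw [this]
  simp

theorem leviCivita_sub (hX : MDiffAt (T% X) x) (hY : MDiffAt (T% Y) x)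
    (v : TangentSpace 𝓘(ℝ, E) x) :
    leviCivita (X - Y) x v = leviCivita X x v - leviCivita Y x v := by
  have h := leviCivita_add (X := X - Y) (mdifferentiableAt_sub_section hX hY) hY v
  rw [sub_add_cancel] at h
  rw [h, add_sub_cancel_right]

theorem leviCivita_congr (hX : MDiffAt (T% X) x) (hY : MDiffAt (T% Y) x)
    (h : ∀ᶠ y in 𝓝 x, X y = Y y) : leviCivita X x = leviCivita Y x :=
  leviCivita.isCovariantDerivativeOnUniv.congr_of_eventuallyEq hX hY univ_mem h

theorem mlieBracket_eq_leviCivita_sub (hX : MDiffAt (T% X) x) (hY : MDiffAt (T% Y) x) :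
    mlieBracket 𝓘(ℝ, E) X Y x = leviCivita Y x (X x) - leviCivita X x (Y x) :=
  ((CovariantDerivative.torsion_eq_zero_iff _).1 leviCivita_torsion hX hY).symm

/-! ### Orthonormal frames -/

/-- `e` is an orthonormal frame of smooth vector fields in a neighbourhood of `x`. -/
structure IsOrthonormalFrameNear {ι : Type*} [Fintype ι]
    (e : ι → Π x : M, TangentSpace 𝓘(ℝ, E) x) (x : M) : Prop where
  smooth : ∀ i, SmoothNear (e i) x
  orthonormal : ∀ᶠ y in 𝓝 x, Orthonormal ℝ (fun i => e i y)
  card_eq : Fintype.card ι = Module.finrank ℝ E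

section Frames

variable {ι : Type*} [Fintype ι] {e : ι → Π x : M, TangentSpace 𝓘(ℝ, E) x}

namespace IsOrthonormalFrameNear

theorem eventually (he : IsOrthonormalFrameNear e x) :
    ∀ᶠ y in 𝓝 x, IsOrthonormalFrameNear e y := by
  have h : ∀ᶠ y in 𝓝 x, ∀ i, SmoothNear (e i) y :=
    Filter.eventually_all.2 fun i => (he.smooth i).eventually
  filter_upwards [h, he.orthonormal.eventually_nhds] with y h1 h2
  exact ⟨h1, h2, he.card_eq⟩

/-- The values at `x` of an orthonormal frame, as an orthonormal basis of the tangent space. -/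
def basis (he : IsOrthonormalFrameNear e x) : OrthonormalBasis ι ℝ (TangentSpace 𝓘(ℝ, E) x) :=
  OrthonormalBasis.mk he.orthonormal.self_of_nhds
    (he.orthonormal.self_of_nhds.linearIndependent.span_eq_top_of_card_eq_finrank'
      he.card_eq).ge

theorem basis_apply (he : IsOrthonormalFrameNear e x) (i : ι) : he.basis i = e i x := by
  simp [basis]

theorem sum_inner_smul (he : IsOrthonormalFrameNear e x) (v : TangentSpace 𝓘(ℝ, E) x) :
    ∑ i, ⟪e i x, v⟫ • e i x = v := by
  simpa [basis_apply] using he.basis.sum_repr' v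

theorem sum_inner_mul_inner (he : IsOrthonormalFrameNear e x) (v w : TangentSpace 𝓘(ℝ, E) x) :
    ∑ i, ⟪v, e i x⟫ * ⟪w, e i x⟫ = ⟪v, w⟫ := by
  have := he.basis.sum_inner_mul_inner v w
  simp only [basis_apply] at this
  rw [← this]
  exact Finset.sum_congr rfl fun i _ => by rw [real_inner_comm w]

theorem ext_inner (he : IsOrthonormalFrameNear e x) {v w : TangentSpace 𝓘(ℝ, E) x}
    (h : ∀ i, ⟪v, e i x⟫ = ⟪w, e i x⟫) : v = w := by
  rw [← he.sum_inner_smul v, ← he.sum_inner_smul w]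
  exact Finset.sum_congr rfl fun i _ => by
    rw [real_inner_comm, h i, real_inner_comm]

theorem smoothNear (he : IsOrthonormalFrameNear e x)
    (h : ∀ i, SmoothFunNear (E := E) (fun y => ⟪X y, e i y⟫) x) : SmoothNear X x := by
  refine (SmoothNear.sum (s := Finset.univ)
    (V := fun i => (fun y => ⟪X y, e i y⟫) • e i) fun i _ =>
      SmoothNear.smul (h i) (he.smooth i)).congr ?_
  filter_upwards [he.eventually] with y hy
  rw [← hy.sum_inner_smul (X y)]
  exact Finset.sum_congr rfl fun i _ => by
    rw [real_inner_comm]; rfl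

end IsOrthonormalFrameNear

theorem SmoothFunNear.koszul [Nontrivial E] (hX : SmoothNear X x) (hY : SmoothNear Y x)
    (hZ : SmoothNear Z x) : SmoothFunNear (E := E) (koszul X Y Z) x :=
  ((((((hX.inner hZ).mvfderiv hY).add ((hY.inner hZ).mvfderiv hX)).sub
    ((hY.inner hX).mvfderiv hZ)).add ((hY.mlieBracket hX).inner hZ)).sub
    ((hY.mlieBracket hZ).inner hX)).sub ((hX.mlieBracket hZ).inner hY)

/-- The components of `∇_Y X` in a smooth orthonormal frame are smooth by the Koszul formula. -/
theorem SmoothNear.leviCivita [Nontrivial E] (he : IsOrthonormalFrameNear e x)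
    (hX : SmoothNear X x) (hY : SmoothNear Y x) :
    SmoothNear (fun y => leviCivita X y (Y y)) x := by
  refine he.smoothNear fun i => ?_
  refine ((SmoothFunNear.const (1 / 2)).mul (SmoothFunNear.koszul hX hY (he.smooth i))).congr ?_
  filter_upwards [hX.eventually, hY.eventually, (he.smooth i).eventually] with y h1 h2 h3
  rw [← two_mul_inner_leviCivitaFun h1.mdiffAt h2.mdiffAt h3.mdiffAt, ← mul_assoc]
  norm_num
  rfl

/-! ### Tensorial operations -/

/-- An operation on vector fields is *tensorial* at `x`, if it is additive and linear over
functions on the vector fields that are smooth near `x`. In contrast to `TensorialAt`, only smooth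
vector fields are considered, so that operations of second order such as the curvature
are covered. -/
structure SmoothTensorialAt {A : Type*} [AddCommGroup A] [Module ℝ A]
    (T : (Π x : M, TangentSpace 𝓘(ℝ, E) x) → A) (x : M) : Prop where
  smul : ∀ {f : M → ℝ} {X : Π x : M, TangentSpace 𝓘(ℝ, E) x},
    SmoothFunNear (E := E) f x → SmoothNear X x → T (f • X) = f x • T X
  add : ∀ {X Y : Π x : M, TangentSpace 𝓘(ℝ, E) x},
    SmoothNear X x → SmoothNear Y x → T (X + Y) = T X + T Y

namespace SmoothTensorialAt

variable {A : Type*} [AddCommGroup A] [Module ℝ A]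
  {T : (Π x : M, TangentSpace 𝓘(ℝ, E) x) → A}

theorem congr (hT : SmoothTensorialAt T x) (hX : SmoothNear X x) (hY : SmoothNear Y x)
    (h : ∀ᶠ y in 𝓝 x, X y = Y y) : T X = T Y := by
  classical
  -- the indicator function of a set on which `X` and `Y` agree is constant near `x`
  let ψ : M → ℝ := fun y => if X y = Y y then 1 else 0
  have hψx : ψ x = 1 := by simp [ψ, h.self_of_nhds]
  have hψ : SmoothFunNear (E := E) ψ x :=
    (SmoothFunNear.const 1).congr (h.mono fun y hy => by simp [ψ, hy])
  have heq : ψ • X = ψ • Y := by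
    funext y
    by_cases hy : X y = Y y <;> simp [ψ, hy]
  calc T X = T (ψ • X) := by simp [hT.smul hψ hX, hψx]
    _ = T Y := by rw [heq, hT.smul hψ hY, hψx, one_smul]

theorem sum (hT : SmoothTensorialAt T x) {κ : Type*} (s : Finset κ)
    {V : κ → Π x : M, TangentSpace 𝓘(ℝ, E) x} (h : ∀ i ∈ s, SmoothNear (V i) x) :
    T (fun y => ∑ i ∈ s, V i y) = ∑ i ∈ s, T (V i) := by
  classical
  induction s using Finset.induction_on with
  | empty =>
    have := hT.smul (SmoothFunNear.const 0) (SmoothNear.zero (x := x))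
    simp only [zero_smul] at this
    simp only [Finset.sum_empty]
    rw [← this]
    congr 1
    funext y
    simp
  | insert a s ha ih =>
    simp only [Finset.mem_insert, forall_eq_or_imp] at h
    simp only [Finset.sum_insert ha, ← ih h.2]
    exact hT.add h.1 (SmoothNear.sum h.2)

theorem eq_sum (hT : SmoothTensorialAt T x) (he : IsOrthonormalFrameNear e x)
    (hX : SmoothNear X x) : T X = ∑ i, ⟪e i x, X x⟫ • T (e i) := by
  have h : ∀ i, SmoothNear ((fun y => ⟪e i y, X y⟫) • e i) x := fun i =>
    SmoothNear.smul ((he.smooth i).inner hX) (he.smooth i)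
  rw [hT.congr hX (SmoothNear.sum fun i _ => h i)
    (he.eventually.mono fun y hy => (hy.sum_inner_smul (X y)).symm),
    hT.sum _ fun i _ => h i]
  exact Finset.sum_congr rfl fun i _ => hT.smul ((he.smooth i).inner hX) (he.smooth i)

/-- The value of a tensorial operation at `x` depends only on the value of the vector field. -/
theorem pointwise (hT : SmoothTensorialAt T x) (he : IsOrthonormalFrameNear e x)
    (hX : SmoothNear X x) (hY : SmoothNear Y x) (h : X x = Y x) : T X = T Y := by
  rw [hT.eq_sum he hX, hT.eq_sum he hY, h]

end SmoothTensorialAt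

end Frames

/-! ### The curvature tensor -/

section Curvature

variable [Nontrivial E] {ι : Type*} [Fintype ι] {e : ι → Π x : M, TangentSpace 𝓘(ℝ, E) x}

theorem curvatureField_swap (X Y Z : Π x : M, TangentSpace 𝓘(ℝ, E) x) (x : M) :
    curvatureField Y X Z x = -curvatureField X Y Z x := by
  simp only [curvatureField, mlieBracket_swap_apply (V := Y) (W := X), map_neg]
  abel

theorem curvatureField_tensorial_left (he : IsOrthonormalFrameNear e x) (hZ : SmoothNear Z x) :
    SmoothTensorialAt (fun X => curvatureField X Y Z x) x where
  smul {f X} hf hX := by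
    have h : (fun y => leviCivita Z y ((f • X) y)) = f • fun y => leviCivita Z y (X y) := by
      funext y; simp
    simp only [curvatureField, h, mlieBracket_smul_left hf.mdiffAt hX.mdiffAt,
      leviCivita_smul hf.mdiffAt (hZ.leviCivita he hX).mdiffAt]
    simp only [Pi.smul_apply', map_smul, map_add]
    module
  add {X X'} hX hX' := by
    have h : (fun y => leviCivita Z y ((X + X') y))
        = (fun y => leviCivita Z y (X y)) + fun y => leviCivita Z y (X' y) := by
      funext y; simp
    simp only [curvatureField, h, mlieBracket_add_left hX.mdiffAt hX'.mdiffAt,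
      leviCivita_add (hZ.leviCivita he hX).mdiffAt (hZ.leviCivita he hX').mdiffAt]
    simp only [Pi.add_apply, map_add]
    module

theorem curvatureField_tensorial_middle (he : IsOrthonormalFrameNear e x)
    (hZ : SmoothNear Z x) : SmoothTensorialAt (fun Y => curvatureField X Y Z x) x where
  smul {f Y} hf hY := by
    simp only [curvatureField_swap _ X, (curvatureField_tensorial_left he hZ).smul hf hY,
      smul_neg]
  add {Y Y'} hY hY' := by
    simp only [curvatureField_swap _ X, (curvatureField_tensorial_left he hZ).add hY hY',
      neg_add]

theorem curvatureField_tensorial_right (he : IsOrthonormalFrameNear e x) (hX : SmoothNear X x)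
    (hY : SmoothNear Y x) : SmoothTensorialAt (fun Z => curvatureField X Y Z x) x where
  smul {f Z} hf hZ := by
    have h : ∀ {V : Π x : M, TangentSpace 𝓘(ℝ, E) x}, SmoothNear V x →
        leviCivita (fun y => leviCivita (f • Z) y (V y)) x
          = leviCivita (f • (fun y => leviCivita Z y (V y))
            + (fun y => mvfderiv 𝓘(ℝ, E) f y (V y)) • Z) x := fun {V} hV => by
      refine leviCivita_congr ((SmoothNear.smul hf hZ).leviCivita he hV).mdiffAt
        ((SmoothNear.smul hf (hZ.leviCivita he hV)).add
          (SmoothNear.smul (hf.mvfderiv hV) hZ)).mdiffAt ?_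
      filter_upwards [hf.eventually, hZ.eventually] with y h1 h2
      simpa using leviCivita_smul h1.mdiffAt h2.mdiffAt (V y)
    simp only [curvatureField, h hX, h hY,
      leviCivita_add (SmoothNear.smul hf (hZ.leviCivita he hX)).mdiffAt
        (SmoothNear.smul (hf.mvfderiv hX) hZ).mdiffAt,
      leviCivita_add (SmoothNear.smul hf (hZ.leviCivita he hY)).mdiffAt
        (SmoothNear.smul (hf.mvfderiv hY) hZ).mdiffAt,
      leviCivita_smul hf.mdiffAt (hZ.leviCivita he hX).mdiffAt,
      leviCivita_smul hf.mdiffAt (hZ.leviCivita he hY).mdiffAt,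
      leviCivita_smul (hf.mvfderiv hX).mdiffAt hZ.mdiffAt,
      leviCivita_smul (hf.mvfderiv hY).mdiffAt hZ.mdiffAt,
      leviCivita_smul hf.mdiffAt hZ.mdiffAt, mvfderiv_mlieBracket hf hX hY]
    module
  add {Z Z'} hZ hZ' := by
    have h : ∀ {V : Π x : M, TangentSpace 𝓘(ℝ, E) x}, SmoothNear V x →
        leviCivita (fun y => leviCivita (Z + Z') y (V y)) x
          = leviCivita ((fun y => leviCivita Z y (V y)) + fun y => leviCivita Z' y (V y)) x :=
      fun {V} hV => by
      refine leviCivita_congr ((hZ.add hZ').leviCivita he hV).mdiffAt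
        ((hZ.leviCivita he hV).add (hZ'.leviCivita he hV)).mdiffAt ?_
      filter_upwards [hZ.eventually, hZ'.eventually] with y h1 h2
      simpa using leviCivita_add h1.mdiffAt h2.mdiffAt (V y)
    simp only [curvatureField, h hX, h hY,
      leviCivita_add (hZ.leviCivita he hX).mdiffAt (hZ'.leviCivita he hX).mdiffAt,
      leviCivita_add (hZ.leviCivita he hY).mdiffAt (hZ'.leviCivita he hY).mdiffAt,
      leviCivita_add hZ.mdiffAt hZ'.mdiffAt]
    module

/-- The expansion of the curvature tensor in an orthonormal frame. -/
theorem curvature_eq_sum (he : IsOrthonormalFrameNear e x) (u v w : TangentSpace 𝓘(ℝ, E) x) :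
    curvature x u v w = ∑ i, ∑ j, ∑ k, (⟪e i x, u⟫ * ⟪e j x, v⟫ * ⟪e k x, w⟫) •
      curvatureField (e i) (e j) (e k) x := by
  rw [curvature, (curvatureField_tensorial_left he (smoothNear_extend w)).eq_sum he
    (smoothNear_extend u)]
  refine Finset.sum_congr rfl fun i _ => ?_
  rw [(curvatureField_tensorial_middle he (smoothNear_extend w)).eq_sum he
    (smoothNear_extend v), Finset.smul_sum]
  refine Finset.sum_congr rfl fun j _ => ?_
  rw [(curvatureField_tensorial_right he (he.smooth i) (he.smooth j)).eq_sum he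
    (smoothNear_extend w), Finset.smul_sum, Finset.smul_sum]
  refine Finset.sum_congr rfl fun k _ => ?_
  simp only [extend_apply_self, smul_smul, mul_assoc]

/-- The Ricci operator may be computed with the given orthonormal frame. -/
theorem ricciOperator_eq_sum (he : IsOrthonormalFrameNear e x) (v : TangentSpace 𝓘(ℝ, E) x) :
    ricciOperator x v = ∑ i, ∑ j, ⟪e i x, v⟫ • curvatureField (e i) (e j) (e j) x := by
  classical
  have hb : ∀ j k, ∑ a, ⟪e j x, stdOrthonormalBasis ℝ (TangentSpace 𝓘(ℝ, E) x) a⟫ *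
      ⟪e k x, stdOrthonormalBasis ℝ (TangentSpace 𝓘(ℝ, E) x) a⟫ = if j = k then 1 else 0 := by
    intro j k
    have := (stdOrthonormalBasis ℝ (TangentSpace 𝓘(ℝ, E) x)).sum_inner_mul_inner (e j x) (e k x)
    rw [orthonormal_iff_ite.1 he.orthonormal.self_of_nhds j k] at this
    rw [← this]
    exact Finset.sum_congr rfl fun a _ => by rw [real_inner_comm (e k x)]
  simp only [ricciOperator, curvature_eq_sum he, mul_assoc]
  rw [Finset.sum_comm]
  refine Finset.sum_congr rfl fun i _ => ?_
  rw [Finset.sum_comm]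
  refine Finset.sum_congr rfl fun j _ => ?_
  rw [Finset.sum_comm]
  simp only [← Finset.sum_smul, ← Finset.mul_sum, hb]
  simp

/-- The connection coefficients `Γᵢⱼₖ = g(∇_{eᵢ} eⱼ, eₖ)` of a frame. -/
def connCoeff (e : ι → Π x : M, TangentSpace 𝓘(ℝ, E) x) (i j k : ι) (y : M) : ℝ :=
  ⟪leviCivita (e j) y (e i y), e k y⟫

/-- The components `Rᵢⱼₖₗ = g(R(eᵢ, eⱼ) eₖ, eₗ)` of the curvature in a frame. -/
def curvCoeff (e : ι → Π x : M, TangentSpace 𝓘(ℝ, E) x) (i j k l : ι) (y : M) : ℝ :=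
  ⟪curvatureField (e i) (e j) (e k) y, e l y⟫

namespace IsOrthonormalFrameNear

theorem smooth_connCoeff (he : IsOrthonormalFrameNear e x) (i j k : ι) :
    SmoothFunNear (E := E) (connCoeff e i j k) x :=
  ((he.smooth j).leviCivita he (he.smooth i)).inner (he.smooth k)

theorem smooth_curvCoeff (he : IsOrthonormalFrameNear e x) (i j k l : ι) :
    SmoothFunNear (E := E) (curvCoeff e i j k l) x :=
  ((((he.smooth k).leviCivita he (he.smooth j)).leviCivita he (he.smooth i)).sub
    (((he.smooth k).leviCivita he (he.smooth i)).leviCivita he (he.smooth j))).sub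
    ((he.smooth k).leviCivita he ((he.smooth i).mlieBracket (he.smooth j))) |>.inner (he.smooth l)

theorem inner_eq (he : IsOrthonormalFrameNear e x) [DecidableEq ι] (i j : ι) :
    ⟪e i x, e j x⟫ = if i = j then 1 else 0 :=
  orthonormal_iff_ite.1 he.orthonormal.self_of_nhds i j

theorem connCoeff_skew (he : IsOrthonormalFrameNear e x) (i j k : ι) :
    connCoeff e i k j x = -connCoeff e i j k x := by
  classical
  have h := mvfderiv_inner_leviCivita (he.smooth i).mdiffAt (he.smooth j).mdiffAt
    (he.smooth k).mdiffAt
  rw [mvfderiv_eq_zero_of_eventually_const (c := if j = k then 1 else 0)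
    (he.eventually.mono fun y hy => hy.inner_eq j k), real_inner_comm _ (e j x)] at h
  simp only [zero_apply] at h
  simp only [connCoeff]
  linarith

theorem mvfderiv_connCoeff_skew (he : IsOrthonormalFrameNear e x) (i j k : ι)
    (v : TangentSpace 𝓘(ℝ, E) x) :
    mvfderiv 𝓘(ℝ, E) (connCoeff e i k j) x v = -mvfderiv 𝓘(ℝ, E) (connCoeff e i j k) x v := by
  rw [mvfderiv_congr (g := -connCoeff e i j k)
    (he.eventually.mono fun y hy => hy.connCoeff_skew i j k), mvfderiv_neg]
  rfl

theorem inner_mlieBracket (he : IsOrthonormalFrameNear e x) (i j k : ι) :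
    ⟪mlieBracket 𝓘(ℝ, E) (e i) (e j) x, e k x⟫ = connCoeff e i j k x - connCoeff e j i k x := by
  rw [mlieBracket_eq_leviCivita_sub (he.smooth i).mdiffAt (he.smooth j).mdiffAt, inner_sub_left]
  rfl

theorem mlieBracket_eq_sum (he : IsOrthonormalFrameNear e x) (i j : ι) :
    mlieBracket 𝓘(ℝ, E) (e i) (e j) x
      = ∑ m, (connCoeff e i j m x - connCoeff e j i m x) • e m x := by
  rw [← he.sum_inner_smul (mlieBracket 𝓘(ℝ, E) (e i) (e j) x)]
  exact Finset.sum_congr rfl fun m _ => by rw [real_inner_comm, he.inner_mlieBracket]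

theorem inner_leviCivita_leviCivita (he : IsOrthonormalFrameNear e x) (i j k l : ι) :
    ⟪leviCivita (fun y => leviCivita (e k) y (e j y)) x (e i x), e l x⟫
      = mvfderiv 𝓘(ℝ, E) (connCoeff e j k l) x (e i x)
        - ∑ m, connCoeff e j k m x * connCoeff e i l m x := by
  have h := mvfderiv_inner_leviCivita (he.smooth i).mdiffAt
    ((he.smooth k).leviCivita he (he.smooth j)).mdiffAt (he.smooth l).mdiffAt
  have h2 := he.sum_inner_mul_inner (leviCivita (e k) x (e j x)) (leviCivita (e l) x (e i x))
  change mvfderiv 𝓘(ℝ, E) (connCoeff e j k l) x (e i x) = _ at h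
  rw [h, ← h2]
  simp only [connCoeff]
  ring

/-- The curvature in terms of the connection coefficients of an orthonormal frame. -/
theorem curvCoeff_eq (he : IsOrthonormalFrameNear e x) (i j k l : ι) :
    curvCoeff e i j k l x = mvfderiv 𝓘(ℝ, E) (connCoeff e j k l) x (e i x)
      - mvfderiv 𝓘(ℝ, E) (connCoeff e i k l) x (e j x)
      - ∑ m, connCoeff e j k m x * connCoeff e i l m x
      + ∑ m, connCoeff e i k m x * connCoeff e j l m x
      - ∑ m, (connCoeff e i j m x - connCoeff e j i m x) * connCoeff e m k l x := by
  have h : ⟪leviCivita (e k) x (mlieBracket 𝓘(ℝ, E) (e i) (e j) x), e l x⟫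
      = ∑ m, (connCoeff e i j m x - connCoeff e j i m x) * connCoeff e m k l x := by
    simp only [he.mlieBracket_eq_sum, map_sum, map_smul, sum_inner, real_inner_smul_left]
    rfl
  rw [curvCoeff, curvatureField, inner_sub_left, inner_sub_left, he.inner_leviCivita_leviCivita,
    he.inner_leviCivita_leviCivita, h]
  ring

theorem curvCoeff_swap_left (e : ι → Π x : M, TangentSpace 𝓘(ℝ, E) x) (i j k l : ι) :
    curvCoeff e j i k l x = -curvCoeff e i j k l x := by
  rw [curvCoeff, curvatureField_swap, inner_neg_left, curvCoeff]

theorem curvCoeff_swap_right (he : IsOrthonormalFrameNear e x) (i j k l : ι) :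
    curvCoeff e i j l k x = -curvCoeff e i j k l x := by
  rw [he.curvCoeff_eq, he.curvCoeff_eq, he.mvfderiv_connCoeff_skew j k l,
    he.mvfderiv_connCoeff_skew i k l]
  have h : ∀ m, connCoeff e m l k x = -connCoeff e m k l x := fun m => he.connCoeff_skew m k l
  have h1 : ∑ m, connCoeff e j l m x * connCoeff e i k m x
      = ∑ m, connCoeff e i k m x * connCoeff e j l m x :=
    Finset.sum_congr rfl fun m _ => mul_comm _ _
  have h2 : ∑ m, connCoeff e i l m x * connCoeff e j k m x
      = ∑ m, connCoeff e j k m x * connCoeff e i l m x :=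
    Finset.sum_congr rfl fun m _ => mul_comm _ _
  simp only [h, h1, h2, mul_neg, Finset.sum_neg_distrib]
  ring

end IsOrthonormalFrameNear

/-- The first Bianchi identity, a consequence of the Jacobi identity for the Lie bracket. -/
theorem curvatureField_cyclic (he : IsOrthonormalFrameNear e x) (hX : SmoothNear X x)
    (hY : SmoothNear Y x) (hZ : SmoothNear Z x) :
    curvatureField X Y Z x + curvatureField Y Z X x + curvatureField Z X Y x = 0 := by
  have : IsManifold 𝓘(ℝ, E) (minSmoothness ℝ 3) M := by
    rw [minSmoothness_of_isRCLikeNormedField]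
    infer_instance
  have hle : minSmoothness ℝ 2 ≤ ∞ := by
    rw [minSmoothness_of_isRCLikeNormedField]; exact ENat.LEInfty.out
  have J := leibniz_identity_mlieBracket_apply (hX.contMDiffAt.of_le hle)
    (hY.contMDiffAt.of_le hle) (hZ.contMDiffAt.of_le hle)
  have key : ∀ {U V W : Π x : M, TangentSpace 𝓘(ℝ, E) x}, SmoothNear U x → SmoothNear V x →
      SmoothNear W x → leviCivita (fun y => leviCivita W y (V y)) x (U x)
        - leviCivita (fun y => leviCivita V y (W y)) x (U x)
        - leviCivita U x (mlieBracket 𝓘(ℝ, E) V W x)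
        = mlieBracket 𝓘(ℝ, E) U (mlieBracket 𝓘(ℝ, E) V W) x := by
    intro U V W hU hV hW
    rw [mlieBracket_eq_leviCivita_sub hU.mdiffAt (hV.mlieBracket hW).mdiffAt,
      ← leviCivita_sub (hW.leviCivita he hV).mdiffAt (hV.leviCivita he hW).mdiffAt,
      leviCivita_congr (X := mlieBracket 𝓘(ℝ, E) V W) (hV.mlieBracket hW).mdiffAt
        ((hW.leviCivita he hV).sub (hV.leviCivita he hW)).mdiffAt]
    filter_upwards [hV.eventually, hW.eventually] with y h1 h2
    exact mlieBracket_eq_leviCivita_sub h1.mdiffAt h2.mdiffAt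
  have h1 := key hX hY hZ
  have h2 := key hY hZ hX
  have h3 := key hZ hX hY
  have e1 : mlieBracket 𝓘(ℝ, E) Y (mlieBracket 𝓘(ℝ, E) Z X) x
      = -mlieBracket 𝓘(ℝ, E) Y (mlieBracket 𝓘(ℝ, E) X Z) x := by
    rw [mlieBracket_swap (V := Z) (W := X), ← neg_one_smul ℝ,
      mlieBracket_const_smul_right (hX.mlieBracket hZ).mdiffAt, neg_one_smul]
  have e2 : mlieBracket 𝓘(ℝ, E) Z (mlieBracket 𝓘(ℝ, E) X Y) x
      = -mlieBracket 𝓘(ℝ, E) (mlieBracket 𝓘(ℝ, E) X Y) Z x := mlieBracket_swap_apply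
  calc curvatureField X Y Z x + curvatureField Y Z X x + curvatureField Z X Y x
      = mlieBracket 𝓘(ℝ, E) X (mlieBracket 𝓘(ℝ, E) Y Z) x
        + mlieBracket 𝓘(ℝ, E) Y (mlieBracket 𝓘(ℝ, E) Z X) x
        + mlieBracket 𝓘(ℝ, E) Z (mlieBracket 𝓘(ℝ, E) X Y) x := by
        rw [← h1, ← h2, ← h3]
        simp only [curvatureField]
        abel
    _ = 0 := by rw [e1, e2, J]; abel

namespace IsOrthonormalFrameNear

theorem curvCoeff_cyclic (he : IsOrthonormalFrameNear e x) (i j k l : ι) :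
    curvCoeff e i j k l x + curvCoeff e j k i l x + curvCoeff e k i j l x = 0 := by
  simp only [curvCoeff, ← inner_add_left,
    curvatureField_cyclic he (he.smooth i) (he.smooth j) (he.smooth k), inner_zero_left]

/-- Pair symmetry of the curvature. -/
theorem curvCoeff_pair (he : IsOrthonormalFrameNear e x) (i j k l : ι) :
    curvCoeff e k l i j x = curvCoeff e i j k l x := by
  have b1 := he.curvCoeff_cyclic i j k l
  have b2 := he.curvCoeff_cyclic j k l i
  have b3 := he.curvCoeff_cyclic k l i j
  have b4 := he.curvCoeff_cyclic l i j k
  have s1 := he.curvCoeff_swap_right i j k l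
  have s2 := he.curvCoeff_swap_right j k i l
  have s3 := he.curvCoeff_swap_right k i j l
  have s4 := he.curvCoeff_swap_right k l i j
  have s5 := he.curvCoeff_swap_right l i j k
  have s6 := he.curvCoeff_swap_right j l i k
  have t1 := curvCoeff_swap_left (x := x) e k i l j
  have t2 := curvCoeff_swap_left (x := x) e j l k i
  linarith

end IsOrthonormalFrameNear

end Curvature

/-! ### Almost contact metric structures and adapted frames -/

section Structure

variable [Nontrivial E] {φ : Π x : M, TangentSpace 𝓘(ℝ, E) x →L[ℝ] TangentSpace 𝓘(ℝ, E) x}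
  {ξ : Π x : M, TangentSpace 𝓘(ℝ, E) x} {η : Π x : M, TangentSpace 𝓘(ℝ, E) x →L[ℝ] ℝ} {α : ℝ}
  {e : Fin 3 → Π x : M, TangentSpace 𝓘(ℝ, E) x} {f₁ f₂ : M → ℝ}

namespace IsAlmostContactMetric

theorem phi_xi (h : IsAlmostContactMetric φ ξ η) (x : M) : φ x (ξ x) = 0 := by
  have h1 : φ x (φ x (ξ x)) = 0 := by rw [h.phi_phi, h.eta_xi]; simp
  have h2 : φ x (ξ x) = η x (φ x (ξ x)) • ξ x := by
    have := h.phi_phi x (φ x (ξ x))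
    rw [h1, map_zero] at this
    exact (neg_add_eq_zero.1 this.symm)
  have h3 : η x (φ x (ξ x)) = 0 := by
    have := congrArg (η x) h1
    rw [h2, map_smul, h2, map_smul, map_smul, h.eta_xi, map_zero] at this
    simpa using this
  rw [h2, h3, zero_smul]

theorem eta_eq (h : IsAlmostContactMetric φ ξ η) (x : M) (v : TangentSpace 𝓘(ℝ, E) x) :
    η x v = ⟪ξ x, v⟫ := by
  have := h.inner_phi_phi x (ξ x) v
  rw [h.phi_xi, inner_zero_left, h.eta_xi] at this
  linarith

theorem eta_phi (h : IsAlmostContactMetric φ ξ η) (x : M) (v : TangentSpace 𝓘(ℝ, E) x) :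
    η x (φ x v) = 0 := by
  have h1 := h.phi_phi x (φ x v)
  rw [h.phi_phi x v, map_add, map_smul, h.phi_xi, map_neg, smul_zero, add_right_inj] at h1
  have := congrArg (η x) h1
  simpa [h.eta_xi] using this.symm

theorem inner_phi_left (h : IsAlmostContactMetric φ ξ η) (x : M)
    (u v : TangentSpace 𝓘(ℝ, E) x) : ⟪φ x u, v⟫ = -⟪u, φ x v⟫ := by
  have h1 := h.inner_phi_phi x u (φ x v)
  rw [h.phi_phi, h.eta_phi, inner_add_right, inner_neg_right, real_inner_smul_right,
    real_inner_comm (ξ x), ← h.eta_eq, h.eta_phi] at h1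
  linarith

theorem smooth_xi (h : IsAlmostContactMetric φ ξ η) : SmoothNear ξ x :=
  Eventually.of_forall fun y => h.contMDiff_xi y

theorem smooth_phi (h : IsAlmostContactMetric φ ξ η) (hX : SmoothNear X x) :
    SmoothNear (fun y => φ y (X y)) x :=
  hX.clm_apply h.contMDiff_phi

end IsAlmostContactMetric

/-- `e` is an orthonormal frame near `x` of the form `(e₀, φ e₀, ξ)`. -/
structure IsAdaptedFrameNear (φ : Π x : M, TangentSpace 𝓘(ℝ, E) x →L[ℝ] TangentSpace 𝓘(ℝ, E) x)
    (ξ : Π x : M, TangentSpace 𝓘(ℝ, E) x) (e : Fin 3 → Π x : M, TangentSpace 𝓘(ℝ, E) x)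
    (x : M) : Prop extends IsOrthonormalFrameNear e x where
  one_eq : e 1 = fun y => φ y (e 0 y)
  two_eq : e 2 = ξ

/-- A unit vector field orthogonal to `ξ` is the first member of an adapted frame. -/
theorem IsAlmostContactMetric.isAdaptedFrameNear (h : IsAlmostContactMetric φ ξ η)
    (hE : Module.finrank ℝ E = 3) (hX : SmoothNear X x) (h1 : ∀ᶠ y in 𝓝 x, ⟪X y, X y⟫ = 1)
    (h2 : ∀ᶠ y in 𝓝 x, ⟪ξ y, X y⟫ = 0) :
    IsAdaptedFrameNear φ ξ ![X, fun y => φ y (X y), ξ] x where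
  smooth i := by
    fin_cases i
    · exact hX
    · exact h.smooth_phi hX
    · exact h.smooth_xi
  orthonormal := by
    filter_upwards [h1, h2] with y h1 h2
    have a1 : ⟪φ y (X y), X y⟫ = 0 := by
      have := h.inner_phi_left y (X y) (X y)
      rw [real_inner_comm] at this
      rw [real_inner_comm]; linarith
    have a2 : ⟪φ y (X y), φ y (X y)⟫ = 1 := by
      rw [h.inner_phi_phi, h.eta_eq, h1, h2]; ring
    have a3 : ⟪ξ y, φ y (X y)⟫ = 0 := by rw [← h.eta_eq, h.eta_phi]
    have a4 : ⟪ξ y, ξ y⟫ = 1 := by rw [← h.eta_eq, h.eta_xi]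
    rw [orthonormal_iff_ite]
    intro i j
    have b1 := real_inner_comm (φ y (X y)) (X y)
    have b2 := real_inner_comm (ξ y) (X y)
    have b3 := real_inner_comm (ξ y) (φ y (X y))
    fin_cases i <;> fin_cases j
    exacts [h1, b1.trans a1, b2.trans h2, a1, a2, b3.trans a3, h2, a3, a4]
  card_eq := by simp [hE]
  one_eq := rfl
  two_eq := rfl

/-- A field orthogonal to `ξ` and nonzero at `x` can be normalized and completed to an
adapted frame. -/
theorem IsAlmostContactMetric.isAdaptedFrameNear_normalize (h : IsAlmostContactMetric φ ξ η)
    (hE : Module.finrank ℝ E = 3) (hX : SmoothNear X x) (h1 : X x ≠ 0)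
    (h2 : ∀ᶠ y in 𝓝 x, ⟪ξ y, X y⟫ = 0) :
    IsAdaptedFrameNear φ ξ ![(fun y => (√⟪X y, X y⟫)⁻¹) • X,
      fun y => φ y (((fun y => (√⟪X y, X y⟫)⁻¹) • X) y), ξ] x := by
  have h0 : ⟪X x, X x⟫ ≠ 0 := inner_self_ne_zero.2 h1
  have hs : SmoothFunNear (E := E) (fun y => (√⟪X y, X y⟫)⁻¹) x :=
    ((hX.inner hX).sqrt h0).inv (Real.sqrt_ne_zero'.2 (real_inner_self_nonneg.lt_of_ne' h0))
  refine h.isAdaptedFrameNear hE (SmoothNear.smul hs hX) ?_ ?_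
  · filter_upwards [(hX.inner hX).contMDiffAt.continuousAt.eventually_ne h0] with y hy
    have hy' : √⟪X y, X y⟫ ≠ 0 := Real.sqrt_ne_zero'.2 (real_inner_self_nonneg.lt_of_ne' hy)
    have := Real.mul_self_sqrt (real_inner_self_nonneg (x := X y))
    simp only [Pi.smul_apply', real_inner_smul_left, real_inner_smul_right]
    field_simp
    linarith
  · filter_upwards [h2] with y hy
    simp [real_inner_smul_right, hy]

theorem IsAlmostContactMetric.exists_isAdaptedFrameNear (h : IsAlmostContactMetric φ ξ η)
    (hE : Module.finrank ℝ E = 3) (x : M) :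
    ∃ e : Fin 3 → Π x : M, TangentSpace 𝓘(ℝ, E) x, IsAdaptedFrameNear φ ξ e x := by
  obtain ⟨w, hw⟩ : ∃ w : TangentSpace 𝓘(ℝ, E) x, w ∉ Submodule.span ℝ {ξ x} := by
    by_contra! hcon
    have h1 : Submodule.span ℝ {ξ x} = ⊤ := (Submodule.eq_top_iff').2 hcon
    have h0 : ξ x ≠ 0 := fun h0 => by simpa [h0] using h.eta_xi x
    have h2 := finrank_span_singleton (K := ℝ) h0
    rw [h1, finrank_top] at h2
    have h3 : Module.finrank ℝ (TangentSpace 𝓘(ℝ, E) x) = 3 := hE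
    omega
  have hW := smoothNear_extend w
  have hs : SmoothNear (extend E w - (fun y => ⟪ξ y, extend E w y⟫) • ξ) x :=
    hW.sub (SmoothNear.smul (h.smooth_xi.inner hW) h.smooth_xi)
  refine ⟨_, h.isAdaptedFrameNear_normalize hE hs ?_ ?_⟩
  · intro h0
    refine hw (Submodule.mem_span_singleton.2 ⟨⟪ξ x, w⟫, ?_⟩)
    simp only [Pi.sub_apply, Pi.smul_apply', extend_apply_self] at h0
    exact (sub_eq_zero.1 h0).symm
  · refine Eventually.of_forall fun y => ?_
    have : ⟪ξ y, ξ y⟫ = 1 := by rw [← h.eta_eq, h.eta_xi]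
    simp only [Pi.sub_apply, Pi.smul_apply', inner_sub_right, real_inner_smul_right, this]
    ring

/-- The covariant derivative `(∇_v φ) X = ∇_v (φ X) - φ (∇_v X)` of the endomorphism field `φ`. -/
def nablaPhi (φ : Π x : M, TangentSpace 𝓘(ℝ, E) x →L[ℝ] TangentSpace 𝓘(ℝ, E) x)
    (x : M) (v : TangentSpace 𝓘(ℝ, E) x) (X : Π x : M, TangentSpace 𝓘(ℝ, E) x) :
    TangentSpace 𝓘(ℝ, E) x :=
  leviCivita (fun y => φ y (X y)) x v - φ x (leviCivita X x v)

namespace IsAlmostContactMetric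

theorem nablaPhi_tensorial (h : IsAlmostContactMetric φ ξ η) (v : TangentSpace 𝓘(ℝ, E) x) :
    SmoothTensorialAt (nablaPhi φ x v) x where
  smul {f X} hf hX := by
    have h1 : (fun y => φ y ((f • X) y)) = f • fun y => φ y (X y) := by funext y; simp
    simp only [nablaPhi, h1, leviCivita_smul hf.mdiffAt (h.smooth_phi hX).mdiffAt,
      leviCivita_smul hf.mdiffAt hX.mdiffAt, map_add, map_smul]
    module
  add {X Y} hX hY := by
    have h1 : (fun y => φ y ((X + Y) y)) = (fun y => φ y (X y)) + fun y => φ y (Y y) := by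
      funext y; simp
    simp only [nablaPhi, h1, leviCivita_add (h.smooth_phi hX).mdiffAt (h.smooth_phi hY).mdiffAt,
      leviCivita_add hX.mdiffAt hY.mdiffAt, map_add]
    module

/-- `2 h v = (∇_ξ φ) v - ∇_{φ v} ξ + φ ∇_v ξ`. -/
theorem hTensor_eq (h : IsAlmostContactMetric φ ξ η) (v : TangentSpace 𝓘(ℝ, E) x) :
    hTensor φ ξ x v = (1 / 2 : ℝ) • (nablaPhi φ x (ξ x) (extend E v)
      - leviCivita ξ x (φ x v) + φ x (leviCivita ξ x v)) := by
  have hV := smoothNear_extend v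
  rw [hTensor, mlieBracket_eq_leviCivita_sub h.smooth_xi.mdiffAt (h.smooth_phi hV).mdiffAt,
    mlieBracket_eq_leviCivita_sub h.smooth_xi.mdiffAt hV.mdiffAt, nablaPhi, extend_apply_self,
    map_sub]
  congr 1
  abel

theorem dOneForm_eq (h : IsAlmostContactMetric φ ξ η) (u v : TangentSpace 𝓘(ℝ, E) x) :
    dOneForm η x u v = ⟪leviCivita ξ x u, v⟫ - ⟪leviCivita ξ x v, u⟫ := by
  have hU := smoothNear_extend u
  have hV := smoothNear_extend v
  have h1 := mvfderiv_inner_leviCivita hU.mdiffAt h.smooth_xi.mdiffAt hV.mdiffAt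
  have h2 := mvfderiv_inner_leviCivita hV.mdiffAt h.smooth_xi.mdiffAt hU.mdiffAt
  simp only [extend_apply_self] at h1 h2
  simp only [dOneForm, h.eta_eq, mlieBracket_eq_leviCivita_sub hU.mdiffAt hV.mdiffAt,
    extend_apply_self, inner_sub_right]
  linarith

/-- `dΦ` is the cyclic sum of `g((∇_u φ) v, w)`. -/
theorem dTwoForm_eq (h : IsAlmostContactMetric φ ξ η) (u v w : TangentSpace 𝓘(ℝ, E) x) :
    dTwoForm (fundamentalForm φ) x u v w = ⟪nablaPhi φ x u (extend E v), w⟫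
      + ⟪nablaPhi φ x v (extend E w), u⟫ + ⟪nablaPhi φ x w (extend E u), v⟫ := by
  have hU := smoothNear_extend u
  have hV := smoothNear_extend v
  have hW := smoothNear_extend w
  have h1 := mvfderiv_inner_leviCivita hU.mdiffAt (h.smooth_phi hV).mdiffAt hW.mdiffAt
  have h2 := mvfderiv_inner_leviCivita hV.mdiffAt (h.smooth_phi hW).mdiffAt hU.mdiffAt
  have h3 := mvfderiv_inner_leviCivita hW.mdiffAt (h.smooth_phi hU).mdiffAt hV.mdiffAt
  simp only [extend_apply_self] at h1 h2 h3
  simp only [dTwoForm, fundamentalForm, h1, h2, h3, nablaPhi,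
    mlieBracket_eq_leviCivita_sub hU.mdiffAt hV.mdiffAt,
    mlieBracket_eq_leviCivita_sub hV.mdiffAt hW.mdiffAt,
    mlieBracket_eq_leviCivita_sub hW.mdiffAt hU.mdiffAt,
    extend_apply_self, map_sub, inner_sub_left, h.inner_phi_left x v, h.inner_phi_left x w,
    h.inner_phi_left x u, real_inner_comm (φ x (leviCivita (extend E w) x u)) v,
    real_inner_comm (φ x (leviCivita (extend E u) x v)) w,
    real_inner_comm (φ x (leviCivita (extend E v) x w)) u]
  ring

end IsAlmostContactMetric

namespace IsAdaptedFrameNear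

theorem eventually (he : IsAdaptedFrameNear φ ξ e x) : ∀ᶠ y in 𝓝 x, IsAdaptedFrameNear φ ξ e y :=
  he.toIsOrthonormalFrameNear.eventually.mono fun _ hy => ⟨hy, he.one_eq, he.two_eq⟩

theorem phi_zero (he : IsAdaptedFrameNear φ ξ e x) : φ x (e 0 x) = e 1 x := by
  rw [he.one_eq]

theorem phi_one (h : IsAlmostContactMetric φ ξ η) (he : IsAdaptedFrameNear φ ξ e x) :
    φ x (e 1 x) = -e 0 x := by
  rw [he.one_eq, h.phi_phi, h.eta_eq, ← he.two_eq, he.inner_eq]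
  simp

theorem phi_two (h : IsAlmostContactMetric φ ξ η) (he : IsAdaptedFrameNear φ ξ e x) :
    φ x (e 2 x) = 0 := by
  rw [he.two_eq, h.phi_xi]

theorem inner_phi_zero (h : IsAlmostContactMetric φ ξ η) (he : IsAdaptedFrameNear φ ξ e x)
    (v : TangentSpace 𝓘(ℝ, E) x) : ⟪φ x v, e 0 x⟫ = -⟪v, e 1 x⟫ := by
  rw [h.inner_phi_left, he.phi_zero]

theorem inner_phi_one (h : IsAlmostContactMetric φ ξ η) (he : IsAdaptedFrameNear φ ξ e x)
    (v : TangentSpace 𝓘(ℝ, E) x) : ⟪φ x v, e 1 x⟫ = ⟪v, e 0 x⟫ := by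
  rw [h.inner_phi_left, he.phi_one h, inner_neg_right, neg_neg]

theorem inner_phi_two (h : IsAlmostContactMetric φ ξ η) (he : IsAdaptedFrameNear φ ξ e x)
    (v : TangentSpace 𝓘(ℝ, E) x) : ⟪φ x v, e 2 x⟫ = 0 := by
  rw [h.inner_phi_left, he.phi_two h, inner_zero_right, neg_zero]

theorem connCoeff_self (he : IsAdaptedFrameNear φ ξ e x) (i j : Fin 3) :
    connCoeff e i j j x = 0 := by
  have := he.connCoeff_skew i j j
  linarith

theorem inner_self (he : IsAdaptedFrameNear φ ξ e x) (i : Fin 3) : ⟪e i x, e i x⟫ = 1 := by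
  rw [he.inner_eq, if_pos rfl]

theorem inner_of_ne (he : IsAdaptedFrameNear φ ξ e x) {i j : Fin 3} (h : i ≠ j) :
    ⟪e i x, e j x⟫ = 0 := by
  rw [he.inner_eq, if_neg h]

theorem ext_inner_three (he : IsAdaptedFrameNear φ ξ e x) {v w : TangentSpace 𝓘(ℝ, E) x}
    (h0 : ⟪v, e 0 x⟫ = ⟪w, e 0 x⟫) (h1 : ⟪v, e 1 x⟫ = ⟪w, e 1 x⟫)
    (h2 : ⟪v, e 2 x⟫ = ⟪w, e 2 x⟫) : v = w :=
  he.ext_inner fun k => by fin_cases k; exacts [h0, h1, h2]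

theorem nablaPhi_extend (h : IsAlmostContactMetric φ ξ η) (he : IsAdaptedFrameNear φ ξ e x)
    (v : TangentSpace 𝓘(ℝ, E) x) (i : Fin 3) :
    nablaPhi φ x v (extend E (e i x)) = nablaPhi φ x v (e i) :=
  (h.nablaPhi_tensorial v).pointwise he.toIsOrthonormalFrameNear (smoothNear_extend _)
    (he.smooth i) (extend_apply_self ..)

theorem leviCivita_phi_one (h : IsAlmostContactMetric φ ξ η) (he : IsAdaptedFrameNear φ ξ e x)
    (v : TangentSpace 𝓘(ℝ, E) x) :
    leviCivita (fun y => φ y (e 1 y)) x v = -leviCivita (e 0) x v := by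
  have h0 : leviCivita ((fun _ : M => (-1 : ℝ)) • e 0) x v = -leviCivita (e 0) x v := by
    rw [leviCivita_smul (SmoothFunNear.const (-1)).mdiffAt (he.smooth 0).mdiffAt, mvfderiv_const]
    simp
  rw [← h0, leviCivita_congr (h.smooth_phi (he.smooth 1)).mdiffAt
    (SmoothNear.smul (SmoothFunNear.const (-1)) (he.smooth 0)).mdiffAt]
  filter_upwards [he.eventually] with y hy
  simp [hy.phi_one h]

theorem leviCivita_phi_two (h : IsAlmostContactMetric φ ξ η) (he : IsAdaptedFrameNear φ ξ e x)
    (v : TangentSpace 𝓘(ℝ, E) x) : leviCivita (fun y => φ y (e 2 y)) x v = 0 := by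
  have h0 : (fun y => φ y (e 2 y)) = 0 := by
    funext y; rw [he.two_eq, h.phi_xi]; rfl
  rw [h0, CovariantDerivative.zero]
  simp

theorem connCoeff_two_symm (h : IsAlmostCosymplectic α φ ξ η) (he : IsAdaptedFrameNear φ ξ e x)
    (i j : Fin 3) : connCoeff e i 2 j x = connCoeff e j 2 i x := by
  have h1 := h.d_eta x (e i x) (e j x)
  rw [h.toIsAlmostContactMetric.dOneForm_eq, ← he.two_eq] at h1
  exact sub_eq_zero.1 h1

/-- `∇_ξ ξ = 0`. -/
theorem connCoeff_two_two (h : IsAlmostCosymplectic α φ ξ η) (he : IsAdaptedFrameNear φ ξ e x)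
    (i : Fin 3) : connCoeff e 2 2 i x = 0 := by
  rw [he.connCoeff_two_symm h, he.connCoeff_self]

/-- `div ξ = 2 α`. -/
theorem connCoeff_trace (h : IsAlmostCosymplectic α φ ξ η) (he : IsAdaptedFrameNear φ ξ e x) :
    connCoeff e 0 2 0 x + connCoeff e 1 2 1 x = 2 * α := by
  have hc := h.toIsAlmostContactMetric
  have h1 := h.d_fundamentalForm x (e 2 x) (e 0 x) (e 1 x)
  rw [hc.dTwoForm_eq, he.nablaPhi_extend hc, he.nablaPhi_extend hc, he.nablaPhi_extend hc] at h1
  have hr : wedgeOneTwo η (fundamentalForm φ) x (e 2 x) (e 0 x) (e 1 x) = 1 := by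
    simp only [wedgeOneTwo, fundamentalForm, hc.eta_eq, ← he.two_eq, he.inner_phi_one hc,
      he.inner_eq]
    simp
  have hl : leviCivita (fun y => φ y (e 0 y)) x (e 2 x) = leviCivita (e 1) x (e 2 x) := by
    rw [he.one_eq]
  simp only [nablaPhi, hl, he.leviCivita_phi_one hc, he.leviCivita_phi_two hc, inner_sub_left,
    he.inner_phi_zero hc, he.inner_phi_one hc, he.inner_phi_two hc, hr, inner_neg_left,
    inner_zero_left] at h1
  have s1 := he.connCoeff_skew 0 2 0
  have s2 := he.connCoeff_self 2 0
  have s3 := he.connCoeff_self 2 1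
  simp only [connCoeff] at s1 s2 s3 ⊢
  linarith

/-! ### The tensor `h` in an adapted frame -/

theorem hTensor_eq_sum (h : IsAlmostContactMetric φ ξ η) (he : IsAdaptedFrameNear φ ξ e x)
    (v : TangentSpace 𝓘(ℝ, E) x) :
    hTensor φ ξ x v = ∑ i, ⟪e i x, v⟫ • hTensor φ ξ x (e i x) := by
  simp only [h.hTensor_eq, he.nablaPhi_extend h]
  have h1 : leviCivita ξ x (φ x v) = ∑ i, ⟪e i x, v⟫ • leviCivita ξ x (φ x (e i x)) := by
    conv_lhs => rw [← he.sum_inner_smul v]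
    simp
  have h2 : φ x (leviCivita ξ x v) = ∑ i, ⟪e i x, v⟫ • φ x (leviCivita ξ x (e i x)) := by
    conv_lhs => rw [← he.sum_inner_smul v]
    simp
  rw [(h.nablaPhi_tensorial (ξ x)).eq_sum he.toIsOrthonormalFrameNear (smoothNear_extend v),
    extend_apply_self, h1, h2]
  simp only [Fin.sum_univ_three]
  module

end IsAdaptedFrameNear

/-- The component `g(h e₀, e₀)` in an adapted frame `e` of an almost `α`-cosymplectic structure. -/
def hDiag (e : Fin 3 → Π x : M, TangentSpace 𝓘(ℝ, E) x) (x : M) : ℝ := -connCoeff e 0 2 1 x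

/-- The component `g(h e₀, φ e₀)` in an adapted frame `e` of an almost `α`-cosymplectic
structure. -/
def hOff (e : Fin 3 → Π x : M, TangentSpace 𝓘(ℝ, E) x) (x : M) : ℝ :=
  (connCoeff e 0 2 0 x - connCoeff e 1 2 1 x) / 2

namespace IsAdaptedFrameNear

theorem hTensor_zero (h : IsAlmostCosymplectic α φ ξ η) (he : IsAdaptedFrameNear φ ξ e x) :
    hTensor φ ξ x (e 0 x) = hDiag e x • e 0 x + hOff e x • e 1 x := by
  have hc := h.toIsAlmostContactMetric
  have hl : leviCivita (fun y => φ y (e 0 y)) x (e 2 x) = leviCivita (e 1) x (e 2 x) := by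
    rw [he.one_eq]
  have s1 := he.connCoeff_two_symm h 0 1
  have s2 := he.connCoeff_skew 2 0 1
  have s3 := he.connCoeff_self 2 0
  have s4 := he.connCoeff_self 2 1
  have s5 := he.connCoeff_self 1 2
  have s6 := he.connCoeff_two_two h 1
  have s7 := he.connCoeff_skew 2 1 2
  rw [hc.hTensor_eq, he.nablaPhi_extend hc, ← he.two_eq, he.phi_zero]
  simp only [nablaPhi, hl, hDiag, hOff]
  simp only [connCoeff] at s1 s2 s3 s4 s5 s6 s7 ⊢
  refine he.ext_inner_three ?_ ?_ ?_ <;>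
    simp only [inner_add_left, inner_sub_left, real_inner_smul_left]
  · rw [he.inner_phi_zero hc, he.inner_phi_zero hc, he.inner_self,
      he.inner_of_ne (show (1 : Fin 3) ≠ 0 by decide)]
    linarith
  · rw [he.inner_phi_one hc, he.inner_phi_one hc, he.inner_self,
      he.inner_of_ne (show (0 : Fin 3) ≠ 1 by decide)]
    linarith
  · rw [he.inner_phi_two hc, he.inner_phi_two hc,
      he.inner_of_ne (show (0 : Fin 3) ≠ 2 by decide),
      he.inner_of_ne (show (1 : Fin 3) ≠ 2 by decide)]
    linarith

theorem hTensor_one (h : IsAlmostCosymplectic α φ ξ η) (he : IsAdaptedFrameNear φ ξ e x) :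
    hTensor φ ξ x (e 1 x) = hOff e x • e 0 x - hDiag e x • e 1 x := by
  have hc := h.toIsAlmostContactMetric
  have s1 := he.connCoeff_two_symm h 0 1
  have s2 := he.connCoeff_skew 2 0 1
  have s3 := he.connCoeff_self 2 0
  have s4 := he.connCoeff_self 2 1
  have s5 := he.connCoeff_self 0 2
  have s6 := he.connCoeff_two_two h 0
  have s7 := he.connCoeff_skew 2 0 2
  rw [hc.hTensor_eq, he.nablaPhi_extend hc, ← he.two_eq, he.phi_one hc]
  simp only [nablaPhi, he.leviCivita_phi_one hc, hDiag, hOff, map_neg]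
  simp only [connCoeff] at s1 s2 s3 s4 s5 s6 s7 ⊢
  refine he.ext_inner_three ?_ ?_ ?_ <;>
    simp only [inner_add_left, inner_sub_left, inner_neg_left, real_inner_smul_left]
  · rw [he.inner_phi_zero hc, he.inner_phi_zero hc, he.inner_self,
      he.inner_of_ne (show (1 : Fin 3) ≠ 0 by decide)]
    linarith
  · rw [he.inner_phi_one hc, he.inner_phi_one hc, he.inner_self,
      he.inner_of_ne (show (0 : Fin 3) ≠ 1 by decide)]
    linarith
  · rw [he.inner_phi_two hc, he.inner_phi_two hc,
      he.inner_of_ne (show (0 : Fin 3) ≠ 2 by decide),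
      he.inner_of_ne (show (1 : Fin 3) ≠ 2 by decide)]
    linarith

theorem hTensor_two (h : IsAlmostCosymplectic α φ ξ η) (he : IsAdaptedFrameNear φ ξ e x) :
    hTensor φ ξ x (e 2 x) = 0 := by
  have hc := h.toIsAlmostContactMetric
  have s6 : leviCivita (e 2) x (e 2 x) = 0 := he.ext_inner fun i => by
    rw [inner_zero_left]; exact he.connCoeff_two_two h i
  rw [hc.hTensor_eq, he.nablaPhi_extend hc, ← he.two_eq, nablaPhi, he.leviCivita_phi_two hc,
    he.phi_two hc, s6]
  simp

end IsAdaptedFrameNear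

/-! ### The structure equations in an adapted frame -/

namespace IsAdaptedFrameNear

theorem smooth_hDiag (he : IsAdaptedFrameNear φ ξ e x) : SmoothFunNear (E := E) (hDiag e) x :=
  (he.smooth_connCoeff 0 2 1).neg

theorem smooth_hOff (he : IsAdaptedFrameNear φ ξ e x) : SmoothFunNear (E := E) (hOff e) x :=
  (((he.smooth_connCoeff 0 2 0).sub (he.smooth_connCoeff 1 2 1)).mul
    (SmoothFunNear.const (1 / 2))).congr (Eventually.of_forall fun y => by
      simp only [hOff]; ring)

theorem connCoeff_020 (h : IsAlmostCosymplectic α φ ξ η) (he : IsAdaptedFrameNear φ ξ e x) :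
    connCoeff e 0 2 0 x = α + hOff e x := by
  have := he.connCoeff_trace h
  simp only [hOff]; linarith

theorem connCoeff_121 (h : IsAlmostCosymplectic α φ ξ η) (he : IsAdaptedFrameNear φ ξ e x) :
    connCoeff e 1 2 1 x = α - hOff e x := by
  have := he.connCoeff_trace h
  simp only [hOff]; linarith

theorem connCoeff_021 (e : Fin 3 → Π x : M, TangentSpace 𝓘(ℝ, E) x) (x : M) :
    connCoeff e 0 2 1 x = -hDiag e x := by
  simp [hDiag]

theorem connCoeff_120 (h : IsAlmostCosymplectic α φ ξ η) (he : IsAdaptedFrameNear φ ξ e x) :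
    connCoeff e 1 2 0 x = -hDiag e x := by
  rw [he.connCoeff_two_symm h, connCoeff_021]

theorem mvfderiv_connCoeff_020 (h : IsAlmostCosymplectic α φ ξ η)
    (he : IsAdaptedFrameNear φ ξ e x) (v : TangentSpace 𝓘(ℝ, E) x) :
    mvfderiv 𝓘(ℝ, E) (connCoeff e 0 2 0) x v = mvfderiv 𝓘(ℝ, E) (hOff e) x v := by
  rw [mvfderiv_congr (g := fun y => α + hOff e y)
    (he.eventually.mono fun y hy => hy.connCoeff_020 h),
    mvfderiv_fun_add (SmoothFunNear.const α).mdiffAt he.smooth_hOff.mdiffAt, mvfderiv_const]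
  simp

theorem mvfderiv_connCoeff_121 (h : IsAlmostCosymplectic α φ ξ η)
    (he : IsAdaptedFrameNear φ ξ e x) (v : TangentSpace 𝓘(ℝ, E) x) :
    mvfderiv 𝓘(ℝ, E) (connCoeff e 1 2 1) x v = -mvfderiv 𝓘(ℝ, E) (hOff e) x v := by
  rw [mvfderiv_congr (g := fun y => α - hOff e y)
    (he.eventually.mono fun y hy => hy.connCoeff_121 h),
    mvfderiv_fun_sub (SmoothFunNear.const α).mdiffAt he.smooth_hOff.mdiffAt, mvfderiv_const]
  simp

theorem mvfderiv_connCoeff_021 (e : Fin 3 → Π x : M, TangentSpace 𝓘(ℝ, E) x) (x : M)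
    (v : TangentSpace 𝓘(ℝ, E) x) :
    mvfderiv 𝓘(ℝ, E) (connCoeff e 0 2 1) x v = -mvfderiv 𝓘(ℝ, E) (hDiag e) x v := by
  rw [mvfderiv_congr (f := connCoeff e 0 2 1) (g := -hDiag e)
    (Eventually.of_forall fun y => connCoeff_021 e y), mvfderiv_neg]
  rfl

theorem mvfderiv_connCoeff_120 (h : IsAlmostCosymplectic α φ ξ η)
    (he : IsAdaptedFrameNear φ ξ e x) (v : TangentSpace 𝓘(ℝ, E) x) :
    mvfderiv 𝓘(ℝ, E) (connCoeff e 1 2 0) x v = -mvfderiv 𝓘(ℝ, E) (hDiag e) x v := by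
  rw [mvfderiv_congr (g := -hDiag e) (he.eventually.mono fun y hy => hy.connCoeff_120 h),
    mvfderiv_neg]
  rfl

theorem mvfderiv_connCoeff_two_two (h : IsAlmostCosymplectic α φ ξ η)
    (he : IsAdaptedFrameNear φ ξ e x) (i : Fin 3) (v : TangentSpace 𝓘(ℝ, E) x) :
    mvfderiv 𝓘(ℝ, E) (connCoeff e 2 2 i) x v = 0 := by
  rw [mvfderiv_eq_zero_of_eventually_const
    (he.eventually.mono fun y hy => hy.connCoeff_two_two h i)]
  rfl

/-! The curvature components `Rᵢⱼₖₗ` below are expressed by `p = g(h e₀, e₀)`, `q = g(h e₀, e₁)`,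
and the coefficients `Γᵢ₀₁` of the connection induced on the planes orthogonal to `ξ`. -/

theorem curvCoeff_0220 (h : IsAlmostCosymplectic α φ ξ η) (he : IsAdaptedFrameNear φ ξ e x) :
    curvCoeff e 0 2 2 0 x = -mvfderiv 𝓘(ℝ, E) (hOff e) x (e 2 x)
      - 2 * connCoeff e 2 0 1 x * hDiag e x - (α + hOff e x) ^ 2 - hDiag e x ^ 2 := by
  rw [he.curvCoeff_eq, he.mvfderiv_connCoeff_two_two h, he.mvfderiv_connCoeff_020 h]
  simp only [Fin.sum_univ_three, he.connCoeff_two_two h, he.connCoeff_self, he.connCoeff_020 h,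
    he.connCoeff_120 h, connCoeff_021]
  ring

theorem curvCoeff_1221 (h : IsAlmostCosymplectic α φ ξ η) (he : IsAdaptedFrameNear φ ξ e x) :
    curvCoeff e 1 2 2 1 x = mvfderiv 𝓘(ℝ, E) (hOff e) x (e 2 x)
      + 2 * connCoeff e 2 0 1 x * hDiag e x - (α - hOff e x) ^ 2 - hDiag e x ^ 2 := by
  rw [he.curvCoeff_eq, he.mvfderiv_connCoeff_two_two h, he.mvfderiv_connCoeff_121 h]
  simp only [Fin.sum_univ_three, he.connCoeff_two_two h, he.connCoeff_skew 2 0 1,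
    he.connCoeff_self, he.connCoeff_121 h, he.connCoeff_120 h, connCoeff_021]
  ring

theorem curvCoeff_0221 (h : IsAlmostCosymplectic α φ ξ η) (he : IsAdaptedFrameNear φ ξ e x) :
    curvCoeff e 0 2 2 1 x = mvfderiv 𝓘(ℝ, E) (hDiag e) x (e 2 x)
      - 2 * connCoeff e 2 0 1 x * hOff e x + 2 * α * hDiag e x := by
  rw [he.curvCoeff_eq, he.mvfderiv_connCoeff_two_two h, mvfderiv_connCoeff_021]
  simp only [Fin.sum_univ_three, he.connCoeff_two_two h, he.connCoeff_skew 2 0 1,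
    he.connCoeff_self, he.connCoeff_020 h, he.connCoeff_121 h, connCoeff_021]
  ring

theorem curvCoeff_0120 (h : IsAlmostCosymplectic α φ ξ η) (he : IsAdaptedFrameNear φ ξ e x) :
    curvCoeff e 0 1 2 0 x = -mvfderiv 𝓘(ℝ, E) (hDiag e) x (e 0 x)
      - mvfderiv 𝓘(ℝ, E) (hOff e) x (e 1 x)
      + 2 * hOff e x * connCoeff e 0 0 1 x - 2 * hDiag e x * connCoeff e 1 0 1 x := by
  rw [he.curvCoeff_eq, he.mvfderiv_connCoeff_120 h, he.mvfderiv_connCoeff_020 h]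
  simp only [Fin.sum_univ_three, he.connCoeff_two_two h, he.connCoeff_skew 0 0 1,
    he.connCoeff_self, he.connCoeff_020 h, he.connCoeff_121 h, he.connCoeff_120 h, connCoeff_021]
  ring

theorem curvCoeff_0121 (h : IsAlmostCosymplectic α φ ξ η) (he : IsAdaptedFrameNear φ ξ e x) :
    curvCoeff e 0 1 2 1 x = -mvfderiv 𝓘(ℝ, E) (hOff e) x (e 0 x)
      + mvfderiv 𝓘(ℝ, E) (hDiag e) x (e 1 x)
      - 2 * hDiag e x * connCoeff e 0 0 1 x - 2 * hOff e x * connCoeff e 1 0 1 x := by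
  rw [he.curvCoeff_eq, he.mvfderiv_connCoeff_121 h, mvfderiv_connCoeff_021]
  simp only [Fin.sum_univ_three, he.connCoeff_two_two h, he.connCoeff_skew 0 0 1,
    he.connCoeff_skew 1 0 1,
    he.connCoeff_self, he.connCoeff_020 h, he.connCoeff_121 h, he.connCoeff_120 h, connCoeff_021]
  ring

theorem curvCoeff_2001 (h : IsAlmostCosymplectic α φ ξ η) (he : IsAdaptedFrameNear φ ξ e x) :
    curvCoeff e 2 0 0 1 x = mvfderiv 𝓘(ℝ, E) (connCoeff e 0 0 1) x (e 2 x)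
      - mvfderiv 𝓘(ℝ, E) (connCoeff e 2 0 1) x (e 0 x)
      + (α + hOff e x) * connCoeff e 0 0 1 x
      - (connCoeff e 2 0 1 x + hDiag e x) * connCoeff e 1 0 1 x := by
  rw [he.curvCoeff_eq]
  simp only [Fin.sum_univ_three, he.connCoeff_two_two h, he.connCoeff_skew 2 2 0,
    he.connCoeff_skew 2 2 1, he.connCoeff_self, he.connCoeff_020 h, connCoeff_021]
  ring

theorem curvCoeff_2101 (h : IsAlmostCosymplectic α φ ξ η) (he : IsAdaptedFrameNear φ ξ e x) :
    curvCoeff e 2 1 0 1 x = mvfderiv 𝓘(ℝ, E) (connCoeff e 1 0 1) x (e 2 x)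
      - mvfderiv 𝓘(ℝ, E) (connCoeff e 2 0 1) x (e 1 x)
      + (connCoeff e 2 0 1 x - hDiag e x) * connCoeff e 0 0 1 x
      + (α - hOff e x) * connCoeff e 1 0 1 x := by
  rw [he.curvCoeff_eq]
  simp only [Fin.sum_univ_three, he.connCoeff_two_two h, he.connCoeff_skew 2 2 0,
    he.connCoeff_skew 2 2 1, he.connCoeff_skew 2 0 1, he.connCoeff_self, he.connCoeff_120 h,
    he.connCoeff_121 h]
  ring

/-! ### The commutator condition on the Ricci operator -/

theorem inner_ricciOperator (he : IsAdaptedFrameNear φ ξ e x) (i k : Fin 3) :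
    ⟪ricciOperator x (e i x), e k x⟫ = ∑ j, curvCoeff e i j j k x := by
  rw [ricciOperator_eq_sum he.toIsOrthonormalFrameNear]
  simp only [he.inner_eq, sum_inner, real_inner_smul_left]
  rw [Finset.sum_eq_single i (fun b _ hb => by simp [hb]) (by simp)]
  simp [curvCoeff]

theorem curvCoeff_diag_left (e : Fin 3 → Π x : M, TangentSpace 𝓘(ℝ, E) x) (i k l : Fin 3)
    (x : M) : curvCoeff e i i k l x = 0 := by
  have := IsOrthonormalFrameNear.curvCoeff_swap_left (x := x) e i i k l
  linarith

theorem curvCoeff_diag_right (he : IsAdaptedFrameNear φ ξ e x) (i j k : Fin 3) :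
    curvCoeff e i j k k x = 0 := by
  have := he.curvCoeff_swap_right i j k k
  linarith

theorem inner_hTensor_zero (h : IsAlmostCosymplectic α φ ξ η) (he : IsAdaptedFrameNear φ ξ e x)
    (v : TangentSpace 𝓘(ℝ, E) x) :
    ⟪hTensor φ ξ x v, e 0 x⟫ = ⟪e 0 x, v⟫ * hDiag e x + ⟪e 1 x, v⟫ * hOff e x := by
  rw [he.hTensor_eq_sum h.toIsAlmostContactMetric, Fin.sum_univ_three, he.hTensor_zero h,
    he.hTensor_one h, he.hTensor_two h]
  simp only [inner_add_left, inner_sub_left, real_inner_smul_left, he.inner_self,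
    he.inner_of_ne (show (1 : Fin 3) ≠ 0 by decide), inner_zero_left]
  ring

theorem inner_hTensor_one (h : IsAlmostCosymplectic α φ ξ η) (he : IsAdaptedFrameNear φ ξ e x)
    (v : TangentSpace 𝓘(ℝ, E) x) :
    ⟪hTensor φ ξ x v, e 1 x⟫ = ⟪e 0 x, v⟫ * hOff e x - ⟪e 1 x, v⟫ * hDiag e x := by
  rw [he.hTensor_eq_sum h.toIsAlmostContactMetric, Fin.sum_univ_three, he.hTensor_zero h,
    he.hTensor_one h, he.hTensor_two h]
  simp only [inner_add_left, inner_sub_left, real_inner_smul_left, he.inner_self,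
    he.inner_of_ne (show (0 : Fin 3) ≠ 1 by decide), inner_zero_left]
  ring

theorem inner_hTensor_two (h : IsAlmostCosymplectic α φ ξ η) (he : IsAdaptedFrameNear φ ξ e x)
    (v : TangentSpace 𝓘(ℝ, E) x) : ⟪hTensor φ ξ x v, e 2 x⟫ = 0 := by
  rw [he.hTensor_eq_sum h.toIsAlmostContactMetric, Fin.sum_univ_three, he.hTensor_zero h,
    he.hTensor_one h, he.hTensor_two h]
  simp only [inner_add_left, inner_sub_left, real_inner_smul_left,
    he.inner_of_ne (show (0 : Fin 3) ≠ 2 by decide),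
    he.inner_of_ne (show (1 : Fin 3) ≠ 2 by decide), inner_zero_left]
  ring

end IsAdaptedFrameNear

/-- The condition `Q φ - φ Q = f₁ h φ + f₂ h` at the point `x`. -/
def RicciCommutatorAt (φ : Π x : M, TangentSpace 𝓘(ℝ, E) x →L[ℝ] TangentSpace 𝓘(ℝ, E) x)
    (ξ : Π x : M, TangentSpace 𝓘(ℝ, E) x) (f₁ f₂ : M → ℝ) (x : M) : Prop :=
  ∀ v : TangentSpace 𝓘(ℝ, E) x, ricciOperator x (φ x v) - φ x (ricciOperator x v)
    = f₁ x • hTensor φ ξ x (φ x v) + f₂ x • hTensor φ ξ x v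

namespace IsAdaptedFrameNear

/-- The commutator condition at `ξ` says that `ξ` is an eigenvector of the Ricci operator. -/
theorem inner_ricciOperator_xi (h : IsAlmostCosymplectic α φ ξ η)
    (he : IsAdaptedFrameNear φ ξ e x) (hQ : RicciCommutatorAt φ ξ f₁ f₂ x) :
    ⟪ricciOperator x (e 2 x), e 0 x⟫ = 0 ∧ ⟪ricciOperator x (e 2 x), e 1 x⟫ = 0 := by
  have hc := h.toIsAlmostContactMetric
  have hQ2 := hQ (e 2 x)
  have h0 : ricciOperator x (0 : TangentSpace 𝓘(ℝ, E) x) = 0 := by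
    rw [ricciOperator_eq_sum he.toIsOrthonormalFrameNear]; simp
  have h1 : hTensor φ ξ x (0 : TangentSpace 𝓘(ℝ, E) x) = 0 := by
    rw [he.hTensor_eq_sum hc]; simp
  rw [he.phi_two hc, h0, h1, he.hTensor_two h, smul_zero, smul_zero, add_zero, zero_sub,
    neg_eq_zero] at hQ2
  constructor
  · rw [← he.inner_phi_one hc, hQ2, inner_zero_left]
  · rw [← neg_eq_zero, ← he.inner_phi_zero hc, hQ2, inner_zero_left]

theorem curvCoeff_2001_eq_zero (h : IsAlmostCosymplectic α φ ξ η)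
    (he : IsAdaptedFrameNear φ ξ e x) (hQ : RicciCommutatorAt φ ξ f₁ f₂ x) :
    curvCoeff e 2 0 0 1 x = 0 := by
  have := (he.inner_ricciOperator_xi h hQ).2
  rw [he.inner_ricciOperator, Fin.sum_univ_three, he.curvCoeff_diag_right,
    curvCoeff_diag_left] at this
  linarith

theorem curvCoeff_2101_eq_zero (h : IsAlmostCosymplectic α φ ξ η)
    (he : IsAdaptedFrameNear φ ξ e x) (hQ : RicciCommutatorAt φ ξ f₁ f₂ x) :
    curvCoeff e 2 1 0 1 x = 0 := by
  have := (he.inner_ricciOperator_xi h hQ).1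
  rw [he.inner_ricciOperator, Fin.sum_univ_three, he.curvCoeff_diag_right,
    curvCoeff_diag_left, he.curvCoeff_swap_right 2 1 0 1] at this
  linarith

theorem curvCoeff_0120_eq_zero (h : IsAlmostCosymplectic α φ ξ η)
    (he : IsAdaptedFrameNear φ ξ e x) (hQ : RicciCommutatorAt φ ξ f₁ f₂ x) :
    curvCoeff e 0 1 2 0 x = 0 := by
  rw [he.curvCoeff_pair 2 0 0 1, he.curvCoeff_2001_eq_zero h hQ]

theorem curvCoeff_0121_eq_zero (h : IsAlmostCosymplectic α φ ξ η)
    (he : IsAdaptedFrameNear φ ξ e x) (hQ : RicciCommutatorAt φ ξ f₁ f₂ x) :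
    curvCoeff e 0 1 2 1 x = 0 := by
  rw [he.curvCoeff_pair 2 1 0 1, he.curvCoeff_2101_eq_zero h hQ]

theorem curvCoeff_1220_eq (he : IsAdaptedFrameNear φ ξ e x) :
    curvCoeff e 1 2 2 0 x = curvCoeff e 0 2 2 1 x := by
  rw [he.curvCoeff_pair 2 0 1 2, IsOrthonormalFrameNear.curvCoeff_swap_left e 0 2 1 2,
    he.curvCoeff_swap_right 0 2 2 1, neg_neg]

theorem two_mul_curvCoeff_0221 (h : IsAlmostCosymplectic α φ ξ η)
    (he : IsAdaptedFrameNear φ ξ e x) (hQ : RicciCommutatorAt φ ξ f₁ f₂ x) :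
    2 * curvCoeff e 0 2 2 1 x = f₁ x * hOff e x + f₂ x * hDiag e x := by
  have hc := h.toIsAlmostContactMetric
  have h0 := congrArg (fun w => ⟪w, e 0 x⟫) (hQ (e 0 x))
  simp only [he.phi_zero, inner_sub_left, inner_add_left, real_inner_smul_left,
    he.inner_phi_zero hc, he.inner_hTensor_zero h, he.inner_ricciOperator, Fin.sum_univ_three,
    he.inner_self, he.inner_of_ne (show (0 : Fin 3) ≠ 1 by decide),
    he.inner_of_ne (show (1 : Fin 3) ≠ 0 by decide), he.curvCoeff_diag_right,
    curvCoeff_diag_left, he.curvCoeff_1220_eq] at h0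
  linarith

theorem curvCoeff_1221_sub_0220 (h : IsAlmostCosymplectic α φ ξ η)
    (he : IsAdaptedFrameNear φ ξ e x) (hQ : RicciCommutatorAt φ ξ f₁ f₂ x) :
    curvCoeff e 1 2 2 1 x - curvCoeff e 0 2 2 0 x
      = -(f₁ x * hDiag e x) + f₂ x * hOff e x := by
  have hc := h.toIsAlmostContactMetric
  have h0 := congrArg (fun w => ⟪w, e 1 x⟫) (hQ (e 0 x))
  have h1 : curvCoeff e 1 0 0 1 x = curvCoeff e 0 1 1 0 x := he.curvCoeff_pair 0 1 1 0
  simp only [he.phi_zero, inner_sub_left, inner_add_left, real_inner_smul_left,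
    he.inner_phi_one hc, he.inner_hTensor_one h, he.inner_ricciOperator, Fin.sum_univ_three,
    he.inner_self, he.inner_of_ne (show (0 : Fin 3) ≠ 1 by decide),
    he.inner_of_ne (show (1 : Fin 3) ≠ 0 by decide), he.curvCoeff_diag_right,
    h1] at h0
  linarith

end IsAdaptedFrameNear

/-! ### The function `κ` -/

/-- The function `κ`, half the Ricci curvature in the direction of `ξ`. -/
def kappa (ξ : Π x : M, TangentSpace 𝓘(ℝ, E) x) (x : M) : ℝ :=
  ⟪ricciOperator x (ξ x), ξ x⟫ / 2

namespace IsAdaptedFrameNear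

theorem kappa_eq_curvCoeff (he : IsAdaptedFrameNear φ ξ e x) :
    kappa ξ x = (curvCoeff e 0 2 2 0 x + curvCoeff e 1 2 2 1 x) / 2 := by
  rw [kappa, ← he.two_eq, he.inner_ricciOperator, Fin.sum_univ_three, curvCoeff_diag_left,
    IsOrthonormalFrameNear.curvCoeff_swap_left e 0 2 0 2, he.curvCoeff_swap_right 0 2 2 0,
    IsOrthonormalFrameNear.curvCoeff_swap_left e 1 2 1 2, he.curvCoeff_swap_right 1 2 2 1]
  ring

/-- `κ = -(α² + ½ tr h²)`. -/
theorem kappa_eq (h : IsAlmostCosymplectic α φ ξ η) (he : IsAdaptedFrameNear φ ξ e x) :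
    kappa ξ x = -(α ^ 2 + hDiag e x ^ 2 + hOff e x ^ 2) := by
  rw [he.kappa_eq_curvCoeff, he.curvCoeff_0220 h, he.curvCoeff_1221 h]
  ring

theorem smooth_kappa (he : IsAdaptedFrameNear φ ξ e x) :
    SmoothFunNear (E := E) (kappa (E := E) ξ) x :=
  (((he.smooth_curvCoeff 0 2 2 0).add (he.smooth_curvCoeff 1 2 2 1)).mul
    (SmoothFunNear.const (1 / 2))).congr (he.eventually.mono fun y hy => by
      rw [hy.kappa_eq_curvCoeff]; ring)

theorem inner_curvature_xi (he : IsAdaptedFrameNear φ ξ e x)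
    (u v : TangentSpace 𝓘(ℝ, E) x) (l : Fin 3) :
    ⟪curvature x u v (ξ x), e l x⟫
      = ∑ i, ∑ j, ⟪e i x, u⟫ * ⟪e j x, v⟫ * curvCoeff e i j 2 l x := by
  rw [curvature_eq_sum he.toIsOrthonormalFrameNear, ← he.two_eq]
  simp only [sum_inner, real_inner_smul_left]
  refine Finset.sum_congr rfl fun i _ => Finset.sum_congr rfl fun j _ => ?_
  rw [Finset.sum_eq_single 2 (fun b _ hb => by rw [he.inner_of_ne hb]; ring) (by simp),
    he.inner_self]
  simp [curvCoeff]

/-- In dimension three the curvature is determined by the Ricci operator, and the commutator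
condition turns into the nullity condition. -/
theorem curvature_xi (h : IsAlmostCosymplectic α φ ξ η) (he : IsAdaptedFrameNear φ ξ e x)
    (hQ : RicciCommutatorAt φ ξ f₁ f₂ x) (u v : TangentSpace 𝓘(ℝ, E) x) :
    curvature x u v (ξ x)
      = η x v • nullityOperator φ ξ (kappa ξ) (fun x => f₁ x / 2) (fun x => f₂ x / 2) x u
        - η x u • nullityOperator φ ξ (kappa ξ) (fun x => f₁ x / 2) (fun x => f₂ x / 2) x v := by
  have hc := h.toIsAlmostContactMetric
  have r1 := he.curvCoeff_0120_eq_zero h hQ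
  have r2 := he.curvCoeff_0121_eq_zero h hQ
  have r3 := he.two_mul_curvCoeff_0221 h hQ
  have r4 := he.curvCoeff_1221_sub_0220 h hQ
  have r5 := he.kappa_eq_curvCoeff
  have r6 := he.curvCoeff_1220_eq
  have k0 : curvCoeff e 0 2 2 0 x = kappa ξ x + f₁ x / 2 * hDiag e x - f₂ x / 2 * hOff e x := by
    linarith
  have k1 : curvCoeff e 1 2 2 1 x = kappa ξ x - f₁ x / 2 * hDiag e x + f₂ x / 2 * hOff e x := by
    linarith
  have k2 : curvCoeff e 0 2 2 1 x = f₁ x / 2 * hOff e x + f₂ x / 2 * hDiag e x := by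
    linarith
  have sw := fun i j l => IsOrthonormalFrameNear.curvCoeff_swap_left (x := x) e i j 2 l
  have hη : ∀ w, η x w = ⟪e 2 x, w⟫ := fun w => by rw [hc.eta_eq, he.two_eq]
  have cu := fun i => real_inner_comm (e i x) u
  have cv := fun i => real_inner_comm (e i x) v
  refine he.ext_inner_three ?_ ?_ ?_ <;>
    simp only [he.inner_curvature_xi, Fin.sum_univ_three, curvCoeff_diag_left, sw 0 1, sw 0 2,
      sw 1 2, nullityOperator, hη, inner_sub_left, inner_add_left, real_inner_smul_left,
      he.curvCoeff_diag_right, he.inner_hTensor_zero h, he.inner_hTensor_one h,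
      he.inner_hTensor_two h, he.inner_phi_zero hc, he.inner_phi_one hc, he.inner_phi_two hc,
      r1, r2, r6, k0, k1, k2, ← cu, ← cv] <;>
    ring

end IsAdaptedFrameNear

/-! ### Frames of eigenvectors of `h` -/

namespace IsAdaptedFrameNear

theorem inner_hTensor_phi (h : IsAlmostCosymplectic α φ ξ η) (he : IsAdaptedFrameNear φ ξ e x)
    (v : TangentSpace 𝓘(ℝ, E) x) :
    ⟪hTensor φ ξ x v, φ x v⟫ = hOff e x * (⟪e 0 x, v⟫ ^ 2 - ⟪e 1 x, v⟫ ^ 2)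
      - 2 * hDiag e x * (⟪e 0 x, v⟫ * ⟪e 1 x, v⟫) := by
  have hc := h.toIsAlmostContactMetric
  have hv : φ x v = ⟪e 0 x, v⟫ • e 1 x - ⟪e 1 x, v⟫ • e 0 x := by
    conv_lhs => rw [← he.sum_inner_smul v]
    rw [Fin.sum_univ_three, map_add, map_add, map_smul, map_smul, map_smul, he.phi_zero,
      he.phi_one hc, he.phi_two hc]
    module
  rw [hv, inner_sub_right, real_inner_smul_right, real_inner_smul_right, he.inner_hTensor_zero h,
    he.inner_hTensor_one h]
  ring

theorem hOff_eq_inner (h : IsAlmostCosymplectic α φ ξ η) (he : IsAdaptedFrameNear φ ξ e x) :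
    hOff e x = ⟪hTensor φ ξ x (e 0 x), φ x (e 0 x)⟫ := by
  rw [he.inner_hTensor_phi h, he.inner_self, he.inner_of_ne (show (1 : Fin 3) ≠ 0 by decide)]
  ring

theorem exists_hOff_eq_zero_of_eventually (h : IsAlmostCosymplectic α φ ξ η)
    (hE : Module.finrank ℝ E = 3) (he : IsAdaptedFrameNear φ ξ e x)
    (hf : SmoothFunNear (E := E) f x) (hg : SmoothFunNear (E := E) g x)
    (h0 : f x ≠ 0 ∨ g x ≠ 0)
    (hfg : ∀ᶠ y in 𝓝 x, hOff e y * (f y ^ 2 - g y ^ 2) - 2 * hDiag e y * (f y * g y) = 0) :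
    ∃ e' : Fin 3 → Π x : M, TangentSpace 𝓘(ℝ, E) x,
      IsAdaptedFrameNear φ ξ e' x ∧ ∀ᶠ y in 𝓝 x, hOff e' y = 0 := by
  have hV : SmoothNear (f • e 0 + g • e 1) x :=
    (SmoothNear.smul hf (he.smooth 0)).add (SmoothNear.smul hg (he.smooth 1))
  have i0 : ∀ {y}, IsAdaptedFrameNear φ ξ e y → ⟪e 0 y, (f • e 0 + g • e 1) y⟫ = f y := by
    intro y hy
    simp only [Pi.add_apply, Pi.smul_apply', inner_add_right, real_inner_smul_right,
      hy.inner_self, hy.inner_of_ne (show (0 : Fin 3) ≠ 1 by decide)]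
    ring
  have i1 : ∀ {y}, IsAdaptedFrameNear φ ξ e y → ⟪e 1 y, (f • e 0 + g • e 1) y⟫ = g y := by
    intro y hy
    simp only [Pi.add_apply, Pi.smul_apply', inner_add_right, real_inner_smul_right,
      hy.inner_self, hy.inner_of_ne (show (1 : Fin 3) ≠ 0 by decide)]
    ring
  have hV0 : (f • e 0 + g • e 1) x ≠ 0 := by
    intro hz
    have a0 := i0 he
    have a1 := i1 he
    rw [hz, inner_zero_right] at a0 a1
    exact h0.elim (fun hh => hh a0.symm) (fun hh => hh a1.symm)
  have hV2 : ∀ᶠ y in 𝓝 x, ⟪ξ y, (f • e 0 + g • e 1) y⟫ = 0 := by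
    filter_upwards [he.eventually] with y hy
    rw [← hy.two_eq]
    simp [inner_add_right, real_inner_smul_right, hy.inner_of_ne (show (2 : Fin 3) ≠ 0 by decide),
      hy.inner_of_ne (show (2 : Fin 3) ≠ 1 by decide)]
  have he' := h.isAdaptedFrameNear_normalize hE hV hV0 hV2
  refine ⟨_, he', ?_⟩
  filter_upwards [he.eventually, he'.eventually, hfg] with y hy hy' hfy
  rw [hy'.hOff_eq_inner h, hy.inner_hTensor_phi h]
  simp only [Matrix.cons_val_zero, Pi.smul_apply', real_inner_smul_right, i0 hy, i1 hy]
  linear_combination (√⟪(f • e 0 + g • e 1) y, (f • e 0 + g • e 1) y⟫)⁻¹ ^ 2 * hfy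

/-- Where `h` does not vanish, it is diagonalized by some adapted frame. -/
theorem exists_hOff_eq_zero (h : IsAlmostCosymplectic α φ ξ η)
    (hE : Module.finrank ℝ E = 3) (he : IsAdaptedFrameNear φ ξ e x)
    (h0 : hDiag e x * hDiag e x + hOff e x * hOff e x ≠ 0) :
    ∃ e' : Fin 3 → Π x : M, TangentSpace 𝓘(ℝ, E) x,
      IsAdaptedFrameNear φ ξ e' x ∧ ∀ᶠ y in 𝓝 x, hOff e' y = 0 := by
  have hp := he.smooth_hDiag
  have hq := he.smooth_hOff
  have hl := ((hp.mul hp).add (hq.mul hq)).sqrt h0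
  have sq : ∀ y, √(hDiag e y * hDiag e y + hOff e y * hOff e y) ^ 2
      = hDiag e y * hDiag e y + hOff e y * hOff e y := fun y =>
    Real.sq_sqrt (add_nonneg (mul_self_nonneg _) (mul_self_nonneg _))
  -- Both `(p + l, q)` and `(q, l - p)` are eigenvectors of `h` for the eigenvalue
  -- `l = √(p² + q²)`, and they do not vanish simultaneously.
  by_cases h1 : hDiag e x + √(hDiag e x * hDiag e x + hOff e x * hOff e x) = 0
  · refine he.exists_hOff_eq_zero_of_eventually h hE hq (hl.sub hp) (Or.inr ?_) ?_
    · have : √(hDiag e x * hDiag e x + hOff e x * hOff e x) ≠ 0 := fun hz => by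
        have := sq x
        rw [hz] at this
        exact h0 (by linarith)
      intro h2
      exact this (by linarith)
    · exact Eventually.of_forall fun y => by linear_combination -hOff e y * sq y
  · refine he.exists_hOff_eq_zero_of_eventually h hE (hp.add hl) hq (Or.inl h1) ?_
    exact Eventually.of_forall fun y => by linear_combination hOff e y * sq y

end IsAdaptedFrameNear

/-! ### The differential of `κ` -/

theorem mvfderiv_mul_apply (hf : SmoothFunNear (E := E) f x) (hg : SmoothFunNear (E := E) g x)
    (v : TangentSpace 𝓘(ℝ, E) x) : mvfderiv 𝓘(ℝ, E) (fun y => f y * g y) x v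
      = f x * mvfderiv 𝓘(ℝ, E) g x v + mvfderiv 𝓘(ℝ, E) f x v * g x := by
  rw [mvfderiv_fun_mul hf.mdiffAt hg.mdiffAt]
  simp
  ring

theorem mvfderiv_const_mul_apply (c : ℝ) (hf : SmoothFunNear (E := E) f x)
    (v : TangentSpace 𝓘(ℝ, E) x) :
    mvfderiv 𝓘(ℝ, E) (fun y => c * f y) x v = c * mvfderiv 𝓘(ℝ, E) f x v := by
  rw [mvfderiv_mul_apply (SmoothFunNear.const c) hf, mvfderiv_const]
  simp

theorem mvfderiv_sub_const_apply (c : ℝ) (hf : SmoothFunNear (E := E) f x)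
    (v : TangentSpace 𝓘(ℝ, E) x) :
    mvfderiv 𝓘(ℝ, E) (fun y => f y - c) x v = mvfderiv 𝓘(ℝ, E) f x v := by
  rw [mvfderiv_fun_sub hf.mdiffAt (SmoothFunNear.const c).mdiffAt, mvfderiv_const]
  simp

namespace IsAdaptedFrameNear

theorem mvfderiv_kappa (h : IsAlmostCosymplectic α φ ξ η) (he : IsAdaptedFrameNear φ ξ e x)
    (v : TangentSpace 𝓘(ℝ, E) x) : mvfderiv 𝓘(ℝ, E) (kappa ξ) x v
      = -2 * (hDiag e x * mvfderiv 𝓘(ℝ, E) (hDiag e) x v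
        + hOff e x * mvfderiv 𝓘(ℝ, E) (hOff e) x v) := by
  have hp := he.smooth_hDiag
  have hq := he.smooth_hOff
  have hk : ∀ᶠ y in 𝓝 x,
      kappa ξ y = (-1) * (hDiag e y * hDiag e y + hOff e y * hOff e y) - α ^ 2 :=
    he.eventually.mono fun y hy => by rw [hy.kappa_eq h]; ring
  rw [mvfderiv_congr hk, mvfderiv_sub_const_apply _
    ((SmoothFunNear.const (-1)).mul ((hp.mul hp).add (hq.mul hq))),
    mvfderiv_const_mul_apply _ ((hp.mul hp).add (hq.mul hq)),
    mvfderiv_fun_add (hp.mul hp).mdiffAt (hq.mul hq).mdiffAt, add_apply,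
    mvfderiv_mul_apply hp hp, mvfderiv_mul_apply hq hq]
  ring

/-- Let `e` consist of eigenvectors of `h` near `x`, with `h e₀ = p e₀`. If `f₁` and `f₂` are
constant in the directions orthogonal to `ξ`, the commutators `[e₀, ξ]` and `[e₁, ξ]` applied to
`p` and the vanishing of the Ricci curvatures `g(Q ξ, eᵢ)` force the coefficients
`Γ₀₀₁` and `Γ₁₀₁` to vanish, so that `p` is constant in these directions as well. -/
theorem mvfderiv_hDiag_eq_zero (h : IsAlmostCosymplectic α φ ξ η)
    (he : IsAdaptedFrameNear φ ξ e x) (hQ : ∀ y, RicciCommutatorAt φ ξ f₁ f₂ y)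
    (hf₁ : SmoothFunNear (E := E) f₁ x) (hf₂ : SmoothFunNear (E := E) f₂ x)
    (hq : ∀ᶠ y in 𝓝 x, hOff e y = 0) (hp : hDiag e x ≠ 0)
    (d₁ : ∀ i : Fin 3, i ≠ 2 → mvfderiv 𝓘(ℝ, E) f₁ x (e i x) = 0)
    (d₂ : ∀ i : Fin 3, i ≠ 2 → mvfderiv 𝓘(ℝ, E) f₂ x (e i x) = 0) (i : Fin 3) (hi : i ≠ 2) :
    mvfderiv 𝓘(ℝ, E) (hDiag e) x (e i x) = 0 := by
  have sp := he.smooth_hDiag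
  have key : ∀ᶠ y in 𝓝 x, connCoeff e 2 0 1 y = (-1 / 4) * f₁ y
      ∧ mvfderiv 𝓘(ℝ, E) (hDiag e) y (e 2 y) = ((1 / 2) * f₂ y - 2 * α) * hDiag e y
      ∧ mvfderiv 𝓘(ℝ, E) (hDiag e) y (e 0 y) = (-2) * (hDiag e y * connCoeff e 1 0 1 y)
      ∧ mvfderiv 𝓘(ℝ, E) (hDiag e) y (e 1 y) = 2 * (hDiag e y * connCoeff e 0 0 1 y) := by
    filter_upwards [he.eventually, hq.eventually_nhds, sp.contMDiffAt.continuousAt.eventually_ne hp]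
      with y hy hqy hpy
    have q0 := hqy.self_of_nhds
    have dq := mvfderiv_eq_zero_of_eventually_const (E := E) hqy
    have r1 := hy.curvCoeff_0120_eq_zero h (hQ y)
    have r2 := hy.curvCoeff_0121_eq_zero h (hQ y)
    have r3 := hy.two_mul_curvCoeff_0221 h (hQ y)
    have r4 := hy.curvCoeff_1221_sub_0220 h (hQ y)
    rw [hy.curvCoeff_0120 h, q0, dq, zero_apply] at r1
    rw [hy.curvCoeff_0121 h, q0, dq, zero_apply] at r2
    rw [hy.curvCoeff_0221 h, q0] at r3
    rw [hy.curvCoeff_1221 h, hy.curvCoeff_0220 h, q0, dq, zero_apply] at r4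
    refine ⟨mul_right_cancel₀ hpy ?_, ?_, ?_, ?_⟩ <;> linarith
  have sb := he.smooth_connCoeff 0 0 1
  have sd := he.smooth_connCoeff 1 0 1
  have sm : SmoothFunNear (E := E) (fun y => (1 / 2) * f₂ y - 2 * α) x :=
    ((SmoothFunNear.const _).mul hf₂).sub (SmoothFunNear.const _)
  obtain ⟨ka, k2, k0, k1⟩ := key.self_of_nhds
  have q0 := hq.self_of_nhds
  have da : ∀ j : Fin 3, j ≠ 2 → mvfderiv 𝓘(ℝ, E) (connCoeff e 2 0 1) x (e j x) = 0 :=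
    fun j hj => by
      rw [mvfderiv_congr (key.mono fun y hy => hy.1), mvfderiv_const_mul_apply _ hf₁, d₁ j hj,
        mul_zero]
  have dm : ∀ j : Fin 3, j ≠ 2 →
      mvfderiv 𝓘(ℝ, E) (fun y => (1 / 2) * f₂ y - 2 * α) x (e j x) = 0 := fun j hj => by
    rw [mvfderiv_sub_const_apply _ ((SmoothFunNear.const _).mul hf₂),
      mvfderiv_const_mul_apply _ hf₂, d₂ j hj, mul_zero]
  have c0 := mvfderiv_mlieBracket sp (he.smooth 0) (he.smooth 2)
  have c1 := mvfderiv_mlieBracket sp (he.smooth 1) (he.smooth 2)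
  rw [he.mlieBracket_eq_sum, Fin.sum_univ_three, map_add, map_add, map_smul, map_smul, map_smul,
    mvfderiv_congr (key.mono fun y hy => hy.2.1), mvfderiv_congr (key.mono fun y hy => hy.2.2.1),
    mvfderiv_mul_apply sm sp, mvfderiv_const_mul_apply _ (sp.mul sd), mvfderiv_mul_apply sp sd,
    dm 0 (by decide), k0, k1, k2] at c0
  rw [he.mlieBracket_eq_sum, Fin.sum_univ_three, map_add, map_add, map_smul, map_smul, map_smul,
    mvfderiv_congr (key.mono fun y hy => hy.2.1), mvfderiv_congr (key.mono fun y hy => hy.2.2.2),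
    mvfderiv_mul_apply sm sp, mvfderiv_const_mul_apply _ (sp.mul sb), mvfderiv_mul_apply sp sb,
    dm 1 (by decide), k0, k1, k2] at c1
  simp only [he.connCoeff_020 h, he.connCoeff_121 h, he.connCoeff_120 h, connCoeff_021,
    he.connCoeff_self, he.connCoeff_two_two h, he.connCoeff_skew 2 0 1, he.connCoeff_skew 2 2 0,
    he.connCoeff_skew 2 2 1,
    smul_eq_mul, q0] at c0 c1
  have r1 := he.curvCoeff_2001_eq_zero h (hQ x)
  have r2 := he.curvCoeff_2101_eq_zero h (hQ x)
  rw [he.curvCoeff_2001 h, da 0 (by decide), q0] at r1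
  rw [he.curvCoeff_2101 h, da 1 (by decide), q0] at r2
  -- `c0`, `r2` both compute `ξ Γ₁₀₁` and `c1`, `r1` both compute `ξ Γ₀₀₁`; the results differ by
  -- `± 2 p Γ₀₀₁` and `± 2 p Γ₁₀₁`.
  have hb : connCoeff e 0 0 1 x = 0 := by
    have : hDiag e x ^ 2 * connCoeff e 0 0 1 x = 0 := by
      linear_combination -(1 / 4) * c0 - hDiag e x / 2 * r2
    exact (mul_eq_zero.1 this).resolve_left (pow_ne_zero 2 hp)
  have hd : connCoeff e 1 0 1 x = 0 := by
    have : hDiag e x ^ 2 * connCoeff e 1 0 1 x = 0 := by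
      linear_combination (1 / 4) * c1 - hDiag e x / 2 * r1
    exact (mul_eq_zero.1 this).resolve_left (pow_ne_zero 2 hp)
  rw [hd] at k0
  rw [hb] at k1
  fin_cases i
  · exact k0.trans (by ring)
  · exact k1.trans (by ring)
  · exact absurd rfl hi

end IsAdaptedFrameNear

/-- If `f₁` and `f₂` are constant in the directions orthogonal to `ξ`, so is `κ`. -/
theorem dWedgeEtaEqZero_kappa (h : IsAlmostCosymplectic α φ ξ η) (hE : Module.finrank ℝ E = 3)
    (hQ : ∀ y, RicciCommutatorAt φ ξ f₁ f₂ y) (hf₁ : ContMDiff 𝓘(ℝ, E) 𝓘(ℝ, ℝ) ∞ f₁)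
    (hf₂ : ContMDiff 𝓘(ℝ, E) 𝓘(ℝ, ℝ) ∞ f₂) (d₁ : DWedgeEtaEqZero η f₁)
    (d₂ : DWedgeEtaEqZero η f₂) : DWedgeEtaEqZero η (kappa ξ) := by
  intro x u v
  have hc := h.toIsAlmostContactMetric
  obtain ⟨e₀, he₀⟩ := hc.exists_isAdaptedFrameNear hE x
  by_cases h0 : hDiag e₀ x * hDiag e₀ x + hOff e₀ x * hOff e₀ x = 0
  -- At a zero of `h` the function `κ = -(α² + p² + q²)` is maximal.
  · obtain ⟨hp, hq⟩ := mul_self_add_mul_self_eq_zero.1 h0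
    rw [he₀.mvfderiv_kappa h, he₀.mvfderiv_kappa h, hp, hq]
    ring
  obtain ⟨e, he, hq⟩ := he₀.exists_hOff_eq_zero h hE h0
  have q0 := hq.self_of_nhds
  have hp : hDiag e x ≠ 0 := fun hp => h0 <| by
    have a := he.kappa_eq h
    have b := he₀.kappa_eq h
    rw [hp, q0] at a
    linarith
  have horth : ∀ {f : M → ℝ}, DWedgeEtaEqZero η f → ∀ i : Fin 3, i ≠ 2 →
      mvfderiv 𝓘(ℝ, E) f x (e i x) = 0 := fun {f} hf i hi => by
    have := hf x (e i x) (e 2 x)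
    rw [hc.eta_eq, hc.eta_eq, ← he.two_eq, he.inner_self, he.inner_of_ne hi.symm] at this
    linarith
  have hk : ∀ i : Fin 3, i ≠ 2 → mvfderiv 𝓘(ℝ, E) (kappa ξ) x (e i x) = 0 := fun i hi => by
    rw [he.mvfderiv_kappa h, q0, he.mvfderiv_hDiag_eq_zero h hQ (.of_contMDiff hf₁)
      (.of_contMDiff hf₂) hq hp (horth d₁) (horth d₂) i hi]
    ring
  have hw : ∀ w, mvfderiv 𝓘(ℝ, E) (kappa ξ) x w
      = η x w * mvfderiv 𝓘(ℝ, E) (kappa ξ) x (e 2 x) := fun w => by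
    conv_lhs => rw [← he.sum_inner_smul w]
    rw [Fin.sum_univ_three, map_add, map_add, map_smul, map_smul, map_smul, hk 0 (by decide),
      hk 1 (by decide), hc.eta_eq, he.two_eq]
    simp
  rw [hw u, hw v]
  ring

end Structure

end AlmostCosymplectic

end

open AlmostCosymplectic in
theorem mainTheorem11
    {M : Type*} [TopologicalSpace M] [T2Space M] [SecondCountableTopology M]
    [ChartedSpace (EuclideanSpace ℝ (Fin 3)) M] [IsManifold (𝓡 3) ∞ M]
    [RiemannianBundle (fun x : M => TangentSpace (𝓡 3) x)]
    [IsContMDiffRiemannianBundle (𝓡 3) ∞ (EuclideanSpace ℝ (Fin 3))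
      (fun x : M => TangentSpace (𝓡 3) x)]
    (α : ℝ)
    (φ : Π x : M, TangentSpace (𝓡 3) x →L[ℝ] TangentSpace (𝓡 3) x)
    (ξ : Π x : M, TangentSpace (𝓡 3) x)
    (η : Π x : M, TangentSpace (𝓡 3) x →L[ℝ] ℝ)
    (hM : IsAlmostCosymplectic α φ ξ η)
    (f₁ f₂ : M → ℝ)
    (hf₁ : ContMDiff (𝓡 3) 𝓘(ℝ, ℝ) ∞ f₁) (hf₂ : ContMDiff (𝓡 3) 𝓘(ℝ, ℝ) ∞ f₂)
    (hQ : ∀ (x : M) (v : TangentSpace (𝓡 3) x),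
      ricciOperator x (φ x v) - φ x (ricciOperator x v)
        = f₁ x • hTensor φ ξ x (φ x v) + f₂ x • hTensor φ ξ x v) :
    ∃ κ : M → ℝ,
      IsAlmostCosymplecticSpace α φ ξ η κ (fun x => f₁ x / 2) (fun x => f₂ x / 2) ∧
      (DWedgeEtaEqZero η f₁ → DWedgeEtaEqZero η f₂ → DWedgeEtaEqZero η κ) := by
  have hE : Module.finrank ℝ (EuclideanSpace ℝ (Fin 3)) = 3 := by simp
  have hf : ∀ {f : M → ℝ}, ContMDiff (𝓡 3) 𝓘(ℝ, ℝ) ∞ f →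
      ContMDiff (𝓡 3) 𝓘(ℝ, ℝ) ∞ (fun x => f x / 2) := fun {f} h =>
    (contDiff_id.div_const 2).contMDiff.comp h
  refine ⟨kappa ξ, ⟨hM, fun x => ?_, hf hf₁, hf hf₂, fun x u v => ?_⟩,
    dWedgeEtaEqZero_kappa hM hE hQ hf₁ hf₂⟩
  · obtain ⟨e, he⟩ := hM.toIsAlmostContactMetric.exists_isAdaptedFrameNear hE x
    exact he.smooth_kappa.contMDiffAt
  · obtain ⟨e, he⟩ := hM.toIsAlmostContactMetric.exists_isAdaptedFrameNear hE x
    exact he.curvature_xi hM (hQ x) u v
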